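/- For positive integers $p,q$ let $$\mathcal Z_{p,q}=\{f\in C([0,1],\mathbb M_p\otimes\mathbb M_q) : f(0)\in\mathbb M_p\otimes 1_q,\ f(1)\in 1_p\otimes\mathbb M_q\}$$ be the dimension drop algebra, called prime if $p$ and $q$ are coprime, and write $c(f(0))\in\mathbb M_p$, $c(f(1))\in\mathbb M_q$ for the matrices with $f(0)=c(f(0))\otimes 1_q$ and $f(1)=1_p\otimes c(f(1))$. Every unital $*$-homomorphism $\iota\colon\mathcal Z_{p,q}\to\mathcal Z_{p',q'}$ is of the form $$\iota(f)(s)=v_s\,\operatorname{diag}\bigl[\underbrace{c(f(0)),\dots,c(f(0))}_{a},\,f(t_1(s)),\dots,f(t_k(s)),\,\underbrace{c(f(1)),\dots,c(f(1))}_{b}\bigr]\,v_s^*\qquad(f\in\mathcal Z_{p,q},\ s\in[0,1])$$ for integers $0\le a<q$, $0\le b<p$, continuous maps $t_1,\dots,t_k\colon[0,1]\to[0,1]$ and unitary matrices $v_s$ of size $p'q'$ (not necessarily continuous in $s$). Under the normalization $t_1\le\dots\le t_k$ the maps $t_1,\dots,t_k$ are unique; they form the normalized eigenvalue pattern of $\iota$.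 The variation of $\iota$ is $V(\iota)=\max_i\operatorname{diam}t_i([0,1])$ (and $V(\iota)=0$ if $k=0$), where $t_1\le\dots\le t_k$ is the normalized eigenvalue pattern of $\iota$. **Proposition.** Let $\{\iota_{n,m}\colon\mathcal Z_{p_m,q_m}\to\mathcal Z_{p_n,q_n}\}_{m\le n}$ be an inductive system, indexed by the natural numbers, of prime dimension drop algebras and unital $*$-homomorphisms, and let $\mathcal Z_0$ be its C*-algebraic inductive limit. Then $\mathcal Z_0$ is simple and monotracial (that is, it has no closed two-sided ideals other than $0$ and $\mathcal Z_0\neq 0$, and it has exactly one tracial state) if and only if $\lim_{n\to\infty}V(\iota_{n,m})=0$ for each $m$. -/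

import Mathlib

open Filter Topology
open scoped Kronecker Matrix.Norms.L2Operator ENNReal

noncomputable section

namespace JiangSu

/-! ### Inductive limits of sequences of unital C*-algebras -/

/-- An inductive system `A 0 → A 1 → A 2 → ⋯` of unital C*-algebras and unital
`*`-homomorphisms; `S.map h : A m → A n` is the connecting map for `h : m ≤ n`. -/
structure CStarSystem (A : ℕ → Type*) [∀ n, CStarAlgebra (A n)] where
  map : ∀ {m n : ℕ}, m ≤ n → A m →⋆ₐ[ℂ] A n
  map_self : ∀ (n : ℕ) (x : A n), map (le_refl n) x = x
  map_map : ∀ {l m n : ℕ} (h₁ : l ≤ m) (h₂ : m ≤ n) (x : A l),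
    map h₂ (map h₁ x) = map (h₁.trans h₂) x

namespace CStarSystem

variable {A : ℕ → Type*} [∀ n, CStarAlgebra (A n)] (S : CStarSystem A)

/-- The `*`-algebra of sequences `x` that are eventually coherent: from some index `m` on,
`x n` is the image of `x m` under the connecting map. Modulo the sequences that are eventually
zero this is the algebraic inductive limit. -/
def coherent : StarSubalgebra ℂ (∀ n, A n) where
  carrier := {x | ∃ m, ∀ (n : ℕ) (h : m ≤ n), S.map h (x m) = x n}
  mul_mem' := by
    rintro x y ⟨m, hm⟩ ⟨k, hk⟩
    refine ⟨max m k, fun n h => ?_⟩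
    have h1 := (hm _ (le_max_left m k))
    have h2 := (hk _ (le_max_right m k))
    rw [Pi.mul_apply, Pi.mul_apply, map_mul, ← h1, ← h2, S.map_map, S.map_map, hm, hk]
  add_mem' := by
    rintro x y ⟨m, hm⟩ ⟨k, hk⟩
    refine ⟨max m k, fun n h => ?_⟩
    have h1 := (hm _ (le_max_left m k))
    have h2 := (hk _ (le_max_right m k))
    rw [Pi.add_apply, Pi.add_apply, map_add, ← h1, ← h2, S.map_map, S.map_map, hm, hk]
  algebraMap_mem' r := ⟨0, fun n h => by
    rw [Pi.algebraMap_apply, Pi.algebraMap_apply, AlgHomClass.commutes]⟩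
  star_mem' := by
    rintro x ⟨m, hm⟩
    exact ⟨m, fun n h => by rw [Pi.star_apply, Pi.star_apply, map_star, hm]⟩

/-- The algebra of eventually coherent sequences, to be given the seminorm
`‖x‖ = lim_n ‖x n‖` (and not a structure inherited from the product). -/
def PreLimit : Type _ := S.coherent

instance : Ring S.PreLimit := inferInstanceAs (Ring S.coherent)
instance : Algebra ℂ S.PreLimit := inferInstanceAs (Algebra ℂ S.coherent)
instance : StarRing S.PreLimit := inferInstanceAs (StarRing S.coherent)
instance : StarModule ℂ S.PreLimit := inferInstanceAs (StarModule ℂ S.coherent)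

variable {S}

/-- The `n`-th entry of an eventually coherent sequence. -/
def PreLimit.entry (x : S.PreLimit) (n : ℕ) : A n := x.1 n

instance : Norm S.PreLimit := ⟨fun x => limsup (fun n => ‖x.entry n‖) atTop⟩

theorem PreLimit.norm_def (x : S.PreLimit) : ‖x‖ = limsup (fun n => ‖x.entry n‖) atTop := rfl

theorem PreLimit.tendsto_norm (x : S.PreLimit) :
    Tendsto (fun n => ‖x.entry n‖) atTop (𝓝 ‖x‖) := by
  obtain ⟨m, hm⟩ := x.2
  have hm' : ∀ (n : ℕ) (h : m ≤ n), S.map h (x.entry m) = x.entry n := hm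
  have hanti : Antitone (fun d => ‖x.entry (m + d)‖) := by
    refine antitone_nat_of_succ_le fun d => ?_
    rw [← hm' (m + (d + 1)) (by omega), ← S.map_map (by omega : m ≤ m + d) (by omega),
      hm' (m + d)]
    exact NonUnitalStarAlgHom.norm_apply_le _ _
  have h1 : ∃ l, Tendsto (fun d => ‖x.entry (m + d)‖) atTop (𝓝 l) :=
    ⟨_, tendsto_atTop_ciInf hanti ⟨0, by rintro _ ⟨d, rfl⟩; exact norm_nonneg _⟩⟩
  obtain ⟨l, hl⟩ := h1
  have h2 : Tendsto (fun n => ‖x.entry n‖) atTop (𝓝 l) := by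
    rw [← tendsto_add_atTop_iff_nat m]
    exact hl.congr fun d => by rw [add_comm m d]
  rw [PreLimit.norm_def, h2.limsup_eq]
  exact h2

instance : SeminormedRing S.PreLimit :=
  { (inferInstance : Ring S.PreLimit),
    AddGroupSeminorm.toSeminormedAddCommGroup (E := S.PreLimit)
      { toFun := fun x => ‖x‖
        map_zero' := tendsto_nhds_unique (PreLimit.tendsto_norm 0) <| by
          refine tendsto_const_nhds.congr fun n => ?_
          exact (norm_zero (E := A n)).symm
        add_le' := fun x y =>
          le_of_tendsto_of_tendsto' (PreLimit.tendsto_norm (x + y))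
            ((PreLimit.tendsto_norm x).add (PreLimit.tendsto_norm y))
            fun n => norm_add_le (x.entry n) (y.entry n)
        neg' := fun x => tendsto_nhds_unique (PreLimit.tendsto_norm (-x)) <|
          (PreLimit.tendsto_norm x).congr fun n => (norm_neg (x.entry n)).symm } with
    norm_mul_le := fun x y =>
      le_of_tendsto_of_tendsto' (PreLimit.tendsto_norm (x * y))
        ((PreLimit.tendsto_norm x).mul (PreLimit.tendsto_norm y))
        fun n => norm_mul_le (x.entry n) (y.entry n) }

instance : NormedAlgebra ℂ S.PreLimit :=
  { (inferInstance : Algebra ℂ S.PreLimit) with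
    norm_smul_le := fun r x =>
      le_of_tendsto_of_tendsto' (PreLimit.tendsto_norm (r • x))
        ((PreLimit.tendsto_norm x).const_mul ‖r‖)
        fun n => norm_smul_le r (x.entry n) }

instance : NormedStarGroup S.PreLimit where
  norm_star_le x := le_of_tendsto_of_tendsto' (PreLimit.tendsto_norm (star x))
    (PreLimit.tendsto_norm x) fun n => (norm_star (x.entry n)).le

theorem PreLimit.norm_sq_le (x : S.PreLimit) : ‖x‖ * ‖x‖ ≤ ‖star x * x‖ :=
  le_of_tendsto_of_tendsto' ((PreLimit.tendsto_norm x).mul (PreLimit.tendsto_norm x))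
    (PreLimit.tendsto_norm (star x * x))
    fun n => (CStarRing.norm_star_mul_self (x := x.entry n)).ge

variable (S)

open UniformSpace

/-- The C*-algebraic inductive limit of the system: the (Hausdorff) completion of the algebraic
inductive limit with respect to the C*-seminorm `lim_n ‖x n‖`. -/
def Limit : Type _ := Completion S.PreLimit

instance : NormedRing S.Limit := inferInstanceAs (NormedRing (Completion S.PreLimit))
instance : CompleteSpace S.Limit := inferInstanceAs (CompleteSpace (Completion S.PreLimit))
instance : Algebra ℂ S.Limit := inferInstanceAs (Algebra ℂ (Completion S.PreLimit))

variable {S}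

/-- The class in the inductive limit of an eventually coherent sequence. -/
def PreLimit.toLimit (x : S.PreLimit) : S.Limit := (x : Completion S.PreLimit)

theorem Limit.ind {P : S.Limit → Prop} (x : S.Limit) (hc : IsClosed {y | P y})
    (h : ∀ y : S.PreLimit, P y.toLimit) : P x :=
  Completion.induction_on (α := S.PreLimit) x hc h

theorem Limit.norm_toLimit (x : S.PreLimit) : ‖x.toLimit‖ = ‖x‖ := Completion.norm_coe x

theorem Limit.toLimit_mul (x y : S.PreLimit) : (x * y).toLimit = x.toLimit * y.toLimit :=
  Completion.coe_mul x y

theorem Limit.toLimit_add (x y : S.PreLimit) : (x + y).toLimit = x.toLimit + y.toLimit :=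
  Completion.coe_add x y

theorem Limit.toLimit_smul (r : ℂ) (x : S.PreLimit) : (r • x).toLimit = r • x.toLimit :=
  Completion.coe_smul r x

instance : NormedAlgebra ℂ S.Limit :=
  { (inferInstance : Algebra ℂ S.Limit) with
    norm_smul_le := fun r x =>
      norm_smul_le (α := ℂ) (β := Completion S.PreLimit) r x }

instance : Star S.Limit := ⟨Completion.map (star : S.PreLimit → S.PreLimit)⟩

theorem Limit.toLimit_star (x : S.PreLimit) : (star x).toLimit = star x.toLimit :=
  (Completion.map_coe (f := (star : S.PreLimit → S.PreLimit))
    (_root_.star_isometry (E := S.PreLimit)).uniformContinuous x).symm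

theorem Limit.continuous_star : Continuous (star : S.Limit → S.Limit) :=
  Completion.continuous_map (f := (star : S.PreLimit → S.PreLimit))

instance : ContinuousStar S.Limit := ⟨Limit.continuous_star⟩

instance : StarRing S.Limit where
  star_involutive x := by
    refine Limit.ind (P := fun x => star (star x) = x) x (isClosed_eq (by fun_prop) (by fun_prop)) fun y => ?_
    rw [← Limit.toLimit_star, ← Limit.toLimit_star, star_star]
  star_mul x y := by
    refine Limit.ind (P := fun x => star (x * y) = star y * star x) x (isClosed_eq (by fun_prop) (by fun_prop)) fun a => ?_
    refine Limit.ind (P := fun y => star (a.toLimit * y) = star y * star a.toLimit) y (isClosed_eq (by fun_prop) (by fun_prop)) fun b => ?_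
    simp only [← Limit.toLimit_star, ← Limit.toLimit_mul, star_mul]
  star_add x y := by
    refine Limit.ind (P := fun x => star (x + y) = star x + star y) x (isClosed_eq (by fun_prop) (by fun_prop)) fun a => ?_
    refine Limit.ind (P := fun y => star (a.toLimit + y) = star a.toLimit + star y) y (isClosed_eq (by fun_prop) (by fun_prop)) fun b => ?_
    simp only [← Limit.toLimit_star, ← Limit.toLimit_add, star_add]

theorem Limit.star_smul (r : ℂ) (x : S.Limit) : star (r • x) = star r • star x := by
  have h : Continuous fun y : S.Limit => r • y := continuous_const_smul r
  have h' : Continuous fun y : S.Limit => star r • y := continuous_const_smul (star r)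
  refine Limit.ind (P := fun x => star (r • x) = star r • star x) x
    (isClosed_eq (Limit.continuous_star.comp h) (h'.comp Limit.continuous_star)) fun y => ?_
  rw [← Limit.toLimit_smul, ← Limit.toLimit_star, ← Limit.toLimit_star, StarModule.star_smul,
    Limit.toLimit_smul]

instance : CStarAlgebra S.Limit where
  norm_mul_self_le x := by
    refine Limit.ind (P := fun x => ‖x‖ * ‖x‖ ≤ ‖star x * x‖) x (isClosed_le (by fun_prop) (by fun_prop)) fun y => ?_
    rw [← Limit.toLimit_star, ← Limit.toLimit_mul, Limit.norm_toLimit, Limit.norm_toLimit]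
    exact PreLimit.norm_sq_le y
  star_smul := Limit.star_smul

end CStarSystem

/-! ### Simplicity and traces -/

/-- A C*-algebra is simple if it is nonzero and its only closed two-sided ideals are `0` and the
whole algebra. -/
def IsSimpleCStarAlgebra (A : Type*) [CStarAlgebra A] : Prop :=
  Nontrivial A ∧ ∀ I : TwoSidedIdeal A, IsClosed (I : Set A) → I = ⊥ ∨ I = ⊤

/-- A tracial state: a linear functional `τ` with `τ 1 = 1`, `τ (a* a) ≥ 0` and
`τ (a b) = τ (b a)`. -/
structure IsTracialState {A : Type*} [CStarAlgebra A] (τ : A →ₗ[ℂ] ℂ) : Prop where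
  map_one : τ 1 = 1
  nonneg : ∀ a : A, 0 ≤ (τ (star a * a)).re ∧ (τ (star a * a)).im = 0
  trace : ∀ a b : A, τ (a * b) = τ (b * a)

/-- A unital C*-algebra is monotracial if it has exactly one tracial state. -/
def IsMonotracial (A : Type*) [CStarAlgebra A] : Prop :=
  ∃! τ : A →ₗ[ℂ] ℂ, IsTracialState τ

/-! ### Dimension drop algebras -/

open scoped unitInterval

/-- The dimension drop algebra `Z_{p,q}`: continuous functions `f` from `[0,1]` to
`M_p ⊗ M_q` with `f 0 ∈ M_p ⊗ 1` and `f 1 ∈ 1 ⊗ M_q`. -/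
def dimensionDrop (p q : ℕ) :
    StarSubalgebra ℂ C(I, Matrix (Fin p × Fin q) (Fin p × Fin q) ℂ) where
  carrier := {f | (∃ a : Matrix (Fin p) (Fin p) ℂ, f 0 = a ⊗ₖ (1 : Matrix (Fin q) (Fin q) ℂ)) ∧
    ∃ b : Matrix (Fin q) (Fin q) ℂ, f 1 = (1 : Matrix (Fin p) (Fin p) ℂ) ⊗ₖ b}
  mul_mem' := by
    rintro f g ⟨⟨a, ha⟩, b, hb⟩ ⟨⟨a', ha'⟩, b', hb'⟩
    exact ⟨⟨a * a', by rw [ContinuousMap.mul_apply, ha, ha', ← Matrix.mul_kronecker_mul, mul_one]⟩,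
      b * b', by rw [ContinuousMap.mul_apply, hb, hb', ← Matrix.mul_kronecker_mul, mul_one]⟩
  add_mem' := by
    rintro f g ⟨⟨a, ha⟩, b, hb⟩ ⟨⟨a', ha'⟩, b', hb'⟩
    exact ⟨⟨a + a', by rw [ContinuousMap.add_apply, ha, ha', Matrix.add_kronecker]⟩,
      b + b', by rw [ContinuousMap.add_apply, hb, hb', Matrix.kronecker_add]⟩
  algebraMap_mem' r :=
    ⟨⟨r • 1, by rw [Matrix.smul_kronecker, Matrix.one_kronecker_one, Algebra.algebraMap_eq_smul_one,
        ContinuousMap.smul_apply, ContinuousMap.one_apply]⟩,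
      r • 1, by rw [Matrix.kronecker_smul, Matrix.one_kronecker_one, Algebra.algebraMap_eq_smul_one,
        ContinuousMap.smul_apply, ContinuousMap.one_apply]⟩
  star_mem' := by
    rintro f ⟨⟨a, ha⟩, b, hb⟩
    refine ⟨⟨star a, ?_⟩, star b, ?_⟩
    · rw [ContinuousMap.star_apply, ha, Matrix.star_eq_conjTranspose,
        Matrix.conjTranspose_kronecker, Matrix.conjTranspose_one, Matrix.star_eq_conjTranspose]
    · rw [ContinuousMap.star_apply, hb, Matrix.star_eq_conjTranspose,
        Matrix.conjTranspose_kronecker, Matrix.conjTranspose_one, Matrix.star_eq_conjTranspose]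

instance isClosed_dimensionDrop (p q : ℕ) :
    IsClosed (dimensionDrop p q :
      Set C(I, Matrix (Fin p × Fin q) (Fin p × Fin q) ℂ)) := by
  let L : Matrix (Fin p) (Fin p) ℂ →ₗ[ℂ] Matrix (Fin p × Fin q) (Fin p × Fin q) ℂ :=
    { toFun := fun a => a ⊗ₖ (1 : Matrix (Fin q) (Fin q) ℂ)
      map_add' := fun a a' => Matrix.add_kronecker a a' _
      map_smul' := fun r a => Matrix.smul_kronecker r a _ }
  let R : Matrix (Fin q) (Fin q) ℂ →ₗ[ℂ] Matrix (Fin p × Fin q) (Fin p × Fin q) ℂ :=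
    { toFun := fun b => (1 : Matrix (Fin p) (Fin p) ℂ) ⊗ₖ b
      map_add' := fun b b' => Matrix.kronecker_add _ b b'
      map_smul' := fun r b => Matrix.kronecker_smul r _ b }
  have hL : IsClosed (LinearMap.range L : Set (Matrix (Fin p × Fin q) (Fin p × Fin q) ℂ)) :=
    Submodule.closed_of_finiteDimensional _
  have hR : IsClosed (LinearMap.range R : Set (Matrix (Fin p × Fin q) (Fin p × Fin q) ℂ)) :=
    Submodule.closed_of_finiteDimensional _
  have h0 := hL.preimage
    (continuous_eval_const (F := C(I, Matrix (Fin p × Fin q) (Fin p × Fin q) ℂ)) (0 : I))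
  have h1 := hR.preimage
    (continuous_eval_const (F := C(I, Matrix (Fin p × Fin q) (Fin p × Fin q) ℂ)) (1 : I))
  convert h0.inter h1 using 1
  ext f
  constructor
  · rintro ⟨⟨a, ha⟩, b, hb⟩
    exact ⟨⟨a, ha.symm⟩, b, hb.symm⟩
  · rintro ⟨⟨a, ha⟩, b, hb⟩
    exact ⟨⟨a, ha.symm⟩, b, hb.symm⟩

/-- `Z_{p,q}` as a type; it is a C*-algebra with the pointwise operations and the supremum of the
operator norms of the values. -/
abbrev DimDrop (p q : ℕ) : Type := dimensionDrop p q

section Pattern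

variable {p q : ℕ}

/-- The matrix `c (f 0) ∈ M_p`, determined by `f 0 = c (f 0) ⊗ 1`. -/
def leftEnd [NeZero q] (f : DimDrop p q) : Matrix (Fin p) (Fin p) ℂ :=
  Matrix.of fun i j => f.1 0 (i, 0) (j, 0)

/-- The matrix `c (f 1) ∈ M_q`, determined by `f 1 = 1 ⊗ c (f 1)`. -/
def rightEnd [NeZero p] (f : DimDrop p q) : Matrix (Fin q) (Fin q) ℂ :=
  Matrix.of fun i j => f.1 1 (0, i) (0, j)

theorem leftEnd_kronecker_one [NeZero q] (f : DimDrop p q) :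
    f.1 0 = leftEnd f ⊗ₖ (1 : Matrix (Fin q) (Fin q) ℂ) := by
  obtain ⟨a, ha⟩ := f.2.1
  have : leftEnd f = a := by
    ext i j
    simp [leftEnd, ha]
  rw [this, ha]

theorem one_kronecker_rightEnd [NeZero p] (f : DimDrop p q) :
    f.1 1 = (1 : Matrix (Fin p) (Fin p) ℂ) ⊗ₖ rightEnd f := by
  obtain ⟨b, hb⟩ := f.2.2
  have : rightEnd f = b := by
    ext i j
    simp [rightEnd, hb]
  rw [this, hb]

variable [NeZero p] [NeZero q] {p' q' : ℕ}

/-- The index set of a block diagonal matrix with `a` blocks of size `p`, followed by `k` blocks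
of size `pq` and `b` blocks of size `q`. -/
abbrev BlockIndex (p q a k b : ℕ) : Type :=
  ((Fin a × Fin p) ⊕ (Fin k × (Fin p × Fin q))) ⊕ (Fin b × Fin q)

/-- The block diagonal matrix
`diag[c (f 0), …, c (f 0), f (t₁ s), …, f (t_k s), c (f 1), …, c (f 1)]`, with `a` copies of
`c (f 0)` and `b` copies of `c (f 1)`. -/
def patternMatrix (a b : ℕ) {k : ℕ} (t : Fin k → C(I, I)) (f : DimDrop p q) (s : I) :
    Matrix (BlockIndex p q a k b) (BlockIndex p q a k b) ℂ :=
  Matrix.fromBlocks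
    (Matrix.fromBlocks
      (Matrix.kronecker (1 : Matrix (Fin a) (Fin a) ℂ) (leftEnd f)) 0
      0 (Matrix.of fun x y => if x.1 = y.1 then f.1 (t x.1 s) x.2 y.2 else 0))
    0 0
    (Matrix.kronecker (1 : Matrix (Fin b) (Fin b) ℂ) (rightEnd f))

/-- `t = (t₁, …, t_k)` is an eigenvalue pattern of the `*`-homomorphism `ι`, with remainder
indices `0 ≤ a < q` and `0 ≤ b < p`: up to an identification `e` of the index sets and unitaries
`v s` of size `p'q'`, which need not depend continuously on `s`, the value `ι f s` is the block
diagonal matrix above. -/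
def IsEigenvaluePattern (ι : DimDrop p q →⋆ₐ[ℂ] DimDrop p' q') (a b : ℕ) {k : ℕ}
    (t : Fin k → C(I, I)) : Prop :=
  a < q ∧ b < p ∧
  ∃ (e : BlockIndex p q a k b ≃ Fin p' × Fin q')
    (v : I → Matrix.unitaryGroup (Fin p' × Fin q') ℂ),
    ∀ (f : DimDrop p q) (s : I),
      (ι f).1 s = (v s : Matrix (Fin p' × Fin q') (Fin p' × Fin q') ℂ) *
        Matrix.reindex e e (patternMatrix a b t f s) *
          star (v s : Matrix (Fin p' × Fin q') (Fin p' × Fin q') ℂ)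

/-- A normalized eigenvalue pattern: `t₁ ≤ ⋯ ≤ t_k` pointwise. -/
def IsNormalizedPattern (ι : DimDrop p q →⋆ₐ[ℂ] DimDrop p' q') {k : ℕ}
    (t : Fin k → C(I, I)) : Prop :=
  (∃ a b : ℕ, IsEigenvaluePattern ι a b t) ∧ ∀ (i j : Fin k), i ≤ j → ∀ s : I, t i s ≤ t j s

/-- The variation of a pattern: the maximum of the diameters of the images of `t₁, …, t_k`
(zero if there are none). -/
def patternVariation {k : ℕ} (t : Fin k → C(I, I)) : ℝ≥0∞ :=
  ⨆ i : Fin k, Metric.ediam (Set.range (t i))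

/-- The variation `V(ι)` of a `*`-homomorphism, that is, the variation of its normalized
eigenvalue pattern. The pattern is unique, so that the infimum is over a single value; it is taken
in `[0,∞]` in order that no value be assigned for want of a pattern. -/
def variation (ι : DimDrop p q →⋆ₐ[ℂ] DimDrop p' q') : ℝ≥0∞ :=
  ⨅ (k : ℕ) (t : Fin k → C(I, I)) (_ : IsNormalizedPattern ι t), patternVariation t

end Pattern

end JiangSu

end

/-!
A representation of `Z_{p,q}` on a finite-dimensional space splits into the eigenspaces of the
central element `s ↦ s • 1`, and on the eigenspace at `y` it is a multiple of `f ↦ f y` or, at the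
ends, of `f ↦ c (f 0)` or `f ↦ c (f 1)`. Applied to `f ↦ ι f s` for each `s`, this gives every
unital `*`-homomorphism `ι` an eigenvalue pattern.

If `V(ι)` is small, then the values of `ι f` at any two points are unitarily equivalent up to a
small error. Hence the normalized trace of `ι f` is nearly a constant function, and its limit along
the system is the only tracial state. Moreover `‖ι f s‖` is nearly constant in `s`, so that a
nonzero element of an ideal of the limit is close to the image of an element which vanishes nowhere
on the interval, hence generates `Z_{p,q}` as an ideal; this forces the ideal to be everything.

Conversely, if `V(ι_{n,m})` does not tend to `0`, then by the pigeonhole principle there are `x < y`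
such that for infinitely many `n` an eigenvalue function of `ι_{n,m}` takes a value below `x` at
some `s` and a value above `y` at some `s'`. The normalized traces at `s` and at `s'` give, along an
ultrafilter, two traces on the limit, equal to the same tracial state `τ`. Counting eigenvalues at
`s` and `s'` with decreasing cut-off functions shows that `τ` gives no mass to the interval between
`x` and `y`. So `τ (g* g) = 0` for a central `g` supported there and equal to `1` at a point which
the eigenvalue function crosses; the image of `g` in the limit has norm at least `1`, whereas a
tracial state on a simple C*-algebra is faithful.
-/

noncomputable section

namespace JiangSu

open scoped unitInterval
open CStarSystem

namespace CStarSystem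

variable {A : ℕ → Type*} [∀ n, CStarAlgebra (A n)] {S : CStarSystem A}

theorem Limit.toLimit_sub (x y : S.PreLimit) : (x - y).toLimit = x.toLimit - y.toLimit :=
  UniformSpace.Completion.coe_sub x y

theorem Limit.toLimit_eq_of_eventually {x y : S.PreLimit}
    (h : ∀ᶠ n in atTop, x.entry n = y.entry n) : x.toLimit = y.toLimit := by
  have hxy : ‖x - y‖ = 0 := by
    refine tendsto_nhds_unique (PreLimit.tendsto_norm (x - y)) (tendsto_const_nhds.congr' ?_)
    filter_upwards [h] with n hn
    exact (norm_eq_zero.2 (sub_eq_zero.2 hn)).symm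
  rw [← sub_eq_zero, ← Limit.toLimit_sub, ← norm_eq_zero, Limit.norm_toLimit, hxy]

/-- The coherent sequence that starts at the index `m` with the value `a`. -/
def preIncl (S : CStarSystem A) (m : ℕ) (a : A m) : S.PreLimit :=
  ⟨fun n => if h : m ≤ n then S.map h a else 0, m, fun n h => by
    simp only [le_refl, h, dif_pos, S.map_self]⟩

theorem entry_preIncl {m n : ℕ} (h : m ≤ n) (a : A m) :
    (S.preIncl m a).entry n = S.map h a := dif_pos h

theorem toLimit_preIncl_eq {m : ℕ} {a : A m} {y : S.PreLimit}
    (h : ∀ (n : ℕ) (hmn : m ≤ n), S.map hmn a = y.entry n) :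
    (S.preIncl m a).toLimit = y.toLimit :=
  Limit.toLimit_eq_of_eventually <|
    (eventually_ge_atTop m).mono fun n hmn => (entry_preIncl hmn a).trans (h n hmn)

/-- The canonical map of the `m`-th algebra of the system to the inductive limit. -/
def incl (S : CStarSystem A) (m : ℕ) : A m →⋆ₐ[ℂ] S.Limit where
  toFun a := (S.preIncl m a).toLimit
  map_one' := toLimit_preIncl_eq (y := 1) fun _ h => map_one (S.map h)
  map_mul' a b := (toLimit_preIncl_eq (y := S.preIncl m a * S.preIncl m b) fun n h => by
    rw [map_mul, ← entry_preIncl h, ← entry_preIncl h]; rfl).trans (Limit.toLimit_mul _ _)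
  map_zero' := toLimit_preIncl_eq (y := 0) fun _ h => map_zero (S.map h)
  map_add' a b := (toLimit_preIncl_eq (y := S.preIncl m a + S.preIncl m b) fun n h => by
    rw [map_add, ← entry_preIncl h, ← entry_preIncl h]; rfl).trans (Limit.toLimit_add _ _)
  commutes' r := by
    rw [Algebra.algebraMap_eq_smul_one (A := S.Limit)]
    exact (toLimit_preIncl_eq (y := r • 1) fun n h => by
      rw [AlgHomClass.commutes, Algebra.algebraMap_eq_smul_one]; rfl).trans
        (Limit.toLimit_smul _ _)
  map_star' a := (toLimit_preIncl_eq (y := star (S.preIncl m a)) fun n h => by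
    rw [map_star, ← entry_preIncl h]; rfl).trans (Limit.toLimit_star _)

theorem incl_apply (m : ℕ) (a : A m) : S.incl m a = (S.preIncl m a).toLimit := rfl

theorem incl_map {m n : ℕ} (h : m ≤ n) (a : A m) : S.incl n (S.map h a) = S.incl m a :=
  toLimit_preIncl_eq fun k hk => by rw [S.map_map, entry_preIncl]

theorem exists_incl_eq (x : S.PreLimit) : ∃ (m : ℕ) (a : A m), S.incl m a = x.toLimit := by
  obtain ⟨m, hm⟩ := x.2
  exact ⟨m, x.1 m, toLimit_preIncl_eq hm⟩

theorem Limit.ind_incl {P : S.Limit → Prop} (x : S.Limit) (hc : IsClosed {y | P y})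
    (h : ∀ (m : ℕ) (a : A m), P (S.incl m a)) : P x :=
  Limit.ind x hc fun y => by
    obtain ⟨m, a, ha⟩ := exists_incl_eq y
    exact ha ▸ h m a

theorem tendsto_norm_preIncl (m : ℕ) (a : A m) :
    Tendsto (fun n => ‖(S.preIncl m a).entry n‖) atTop (𝓝 ‖S.incl m a‖) := by
  rw [incl_apply, Limit.norm_toLimit]
  exact PreLimit.tendsto_norm _

theorem le_norm_incl {m : ℕ} {a : A m} {r : ℝ} {l : Filter ℕ} [l.NeBot] (hl : l ≤ atTop)
    (h : ∀ᶠ n in l, ∃ hmn : m ≤ n, r ≤ ‖S.map hmn a‖) : r ≤ ‖S.incl m a‖ := by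
  refine ge_of_tendsto ((tendsto_norm_preIncl m a).mono_left hl) (h.mono fun n hn => ?_)
  obtain ⟨hmn, hr⟩ := hn
  rwa [entry_preIncl hmn]

end CStarSystem

section Amplification

variable {m n : Type*} [Fintype m] [Fintype n] [DecidableEq m] [DecidableEq n]

/-- The embedding `a ↦ a ⊗ 1` of the left tensor factor of a matrix algebra. -/
def ampLeft : Matrix m m ℂ →⋆ₐ[ℂ] Matrix (m × n) (m × n) ℂ where
  toFun a := a ⊗ₖ 1
  map_one' := Matrix.one_kronecker_one
  map_mul' a b := by rw [← Matrix.mul_kronecker_mul, one_mul]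
  map_zero' := Matrix.zero_kronecker _
  map_add' a b := Matrix.add_kronecker a b _
  commutes' r := by
    rw [Algebra.algebraMap_eq_smul_one, Algebra.algebraMap_eq_smul_one, Matrix.smul_kronecker,
      Matrix.one_kronecker_one]
  map_star' a := by
    rw [Matrix.star_eq_conjTranspose, Matrix.star_eq_conjTranspose,
      Matrix.conjTranspose_kronecker, Matrix.conjTranspose_one]

theorem ampLeft_apply (a : Matrix m m ℂ) : ampLeft (n := n) a = a ⊗ₖ 1 := rfl

/-- The embedding `b ↦ 1 ⊗ b` of the right tensor factor of a matrix algebra. -/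
def ampRight : Matrix n n ℂ →⋆ₐ[ℂ] Matrix (m × n) (m × n) ℂ where
  toFun b := 1 ⊗ₖ b
  map_one' := Matrix.one_kronecker_one
  map_mul' a b := by rw [← Matrix.mul_kronecker_mul, one_mul]
  map_zero' := Matrix.kronecker_zero _
  map_add' a b := Matrix.kronecker_add _ a b
  commutes' r := by
    rw [Algebra.algebraMap_eq_smul_one, Algebra.algebraMap_eq_smul_one, Matrix.kronecker_smul,
      Matrix.one_kronecker_one]
  map_star' b := by
    rw [Matrix.star_eq_conjTranspose, Matrix.star_eq_conjTranspose,
      Matrix.conjTranspose_kronecker, Matrix.conjTranspose_one]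

theorem ampRight_apply (b : Matrix n n ℂ) : ampRight (m := m) b = 1 ⊗ₖ b := rfl

end Amplification

section Elements

variable {p q : ℕ}

namespace DimDrop

theorem ext {f g : DimDrop p q} (h : ∀ s, f.1 s = g.1 s) : f = g :=
  Subtype.ext (ContinuousMap.ext h)

theorem mul_apply (f g : DimDrop p q) (s : I) : (f * g).1 s = f.1 s * g.1 s := rfl

theorem star_apply (f : DimDrop p q) (s : I) : (star f).1 s = star (f.1 s) := rfl

theorem one_apply (s : I) : (1 : DimDrop p q).1 s = 1 := rfl

theorem norm_apply_le (f : DimDrop p q) (s : I) : ‖f.1 s‖ ≤ ‖f‖ :=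
  f.1.norm_coe_le_norm s

theorem norm_le {f : DimDrop p q} {r : ℝ} (hr : 0 ≤ r) (h : ∀ s, ‖f.1 s‖ ≤ r) : ‖f‖ ≤ r :=
  (ContinuousMap.norm_le _ hr).2 h

end DimDrop

/-- Evaluation at a point of the interval; onto the full matrix algebra except at the ends. -/
def evalHom (s : I) : DimDrop p q →⋆ₐ[ℂ] Matrix (Fin p × Fin q) (Fin p × Fin q) ℂ where
  toFun f := f.1 s
  map_one' := rfl
  map_mul' _ _ := rfl
  map_zero' := rfl
  map_add' _ _ := rfl
  commutes' _ := rfl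
  map_star' _ := rfl

theorem evalHom_apply (s : I) (f : DimDrop p q) : evalHom s f = f.1 s := rfl

section Scaled

variable {d : Type*} [Fintype d] [DecidableEq d]
  {ψ : Matrix d d ℂ →⋆ₐ[ℂ] Matrix (Fin p × Fin q) (Fin p × Fin q) ℂ} {g h : C(I, ℂ)}

/-- The boundary conditions under which the functions `s ↦ g s • ψ A` belong to the dimension drop
algebra. -/
structure IsCompatible (ψ : Matrix d d ℂ →⋆ₐ[ℂ] Matrix (Fin p × Fin q) (Fin p × Fin q) ℂ)
    (g : C(I, ℂ)) : Prop where
  left : g 0 = 0 ∨ ∀ A, ∃ a, ψ A = ampLeft a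
  right : g 1 = 0 ∨ ∀ A, ∃ b, ψ A = ampRight b

theorem IsCompatible.mul_right (hg : IsCompatible ψ g) (h : C(I, ℂ)) : IsCompatible ψ (g * h) where
  left := hg.left.imp_left fun h0 => by rw [ContinuousMap.mul_apply, h0, zero_mul]
  right := hg.right.imp_left fun h1 => by rw [ContinuousMap.mul_apply, h1, zero_mul]

theorem isCompatible_id (h0 : g 0 = 0) (h1 : g 1 = 0) :
    IsCompatible (StarAlgHom.id ℂ (Matrix (Fin p × Fin q) (Fin p × Fin q) ℂ)) g :=
  ⟨.inl h0, .inl h1⟩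

theorem isCompatible_ampLeft (h1 : g 1 = 0) : IsCompatible (p := p) (q := q) ampLeft g :=
  ⟨.inr fun a => ⟨a, rfl⟩, .inl h1⟩

theorem isCompatible_ampRight (h0 : g 0 = 0) : IsCompatible (p := p) (q := q) ampRight g :=
  ⟨.inl h0, .inr fun b => ⟨b, rfl⟩⟩

/-- The functions `s ↦ g s • ψ A` in the dimension drop algebra. With `ψ` the identity,
`ampLeft` or `ampRight` these span the functions vanishing at both ends, at `1` and at `0`. -/
def scaled (ψ : Matrix d d ℂ →⋆ₐ[ℂ] Matrix (Fin p × Fin q) (Fin p × Fin q) ℂ) (g : C(I, ℂ))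
    (hg : IsCompatible ψ g) : Matrix d d ℂ →ₗ[ℂ] DimDrop p q where
  toFun A := ⟨⟨fun s => g s • ψ A, by fun_prop⟩, by
    constructor
    · rcases hg.left with h0 | h0
      · exact ⟨0, by simp [h0]⟩
      · obtain ⟨a, ha⟩ := h0 A
        exact ⟨g 0 • a, by simp [ha, ampLeft_apply, Matrix.smul_kronecker]⟩
    · rcases hg.right with h1 | h1
      · exact ⟨0, by simp [h1]⟩
      · obtain ⟨b, hb⟩ := h1 A
        exact ⟨g 1 • b, by simp [hb, ampRight_apply, Matrix.kronecker_smul]⟩⟩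
  map_add' A B := DimDrop.ext fun s => by
    change g s • ψ (A + B) = g s • ψ A + g s • ψ B
    rw [map_add, smul_add]
  map_smul' r A := DimDrop.ext fun s => by
    change g s • ψ (r • A) = r • g s • ψ A
    rw [map_smul, smul_comm]

theorem scaled_apply (hg : IsCompatible ψ g) (A : Matrix d d ℂ) (s : I) :
    (scaled ψ g hg A).1 s = g s • ψ A := rfl

theorem scaled_mul_scaled (hg : IsCompatible ψ g) (hh : IsCompatible ψ h) (A B : Matrix d d ℂ) :
    scaled ψ g hg A * scaled ψ h hh B = scaled ψ (g * h) (hg.mul_right h) (A * B) :=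
  DimDrop.ext fun s => by
    rw [DimDrop.mul_apply, scaled_apply, scaled_apply, scaled_apply, map_mul, smul_mul_smul_comm,
      ContinuousMap.mul_apply]

end Scaled

/-- The inclusion of the scalar functions `s ↦ g s • 1`. -/
def central : C(I, ℂ) →⋆ₐ[ℂ] DimDrop p q where
  toFun g := ⟨⟨fun s => g s • 1, by fun_prop⟩,
    ⟨g 0 • 1, by simp [Matrix.smul_kronecker]⟩, ⟨g 1 • 1, by simp [Matrix.kronecker_smul]⟩⟩
  map_one' := DimDrop.ext fun _ => one_smul ℂ _
  map_mul' g h := DimDrop.ext fun s => by simp [smul_smul, mul_comm (g s)]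
  map_zero' := DimDrop.ext fun _ => zero_smul ℂ _
  map_add' g h := DimDrop.ext fun s => add_smul (g s) (h s) _
  commutes' r := DimDrop.ext fun _ => (Algebra.algebraMap_eq_smul_one r).symm
  map_star' g := DimDrop.ext fun s => by simp

theorem central_apply (g : C(I, ℂ)) (s : I) : (central g : DimDrop p q).1 s = g s • 1 := rfl

theorem central_mul_apply (g : C(I, ℂ)) (f : DimDrop p q) (s : I) :
    (central g * f).1 s = g s • f.1 s := by
  rw [DimDrop.mul_apply, central_apply, smul_one_mul]

theorem central_mul_comm (g : C(I, ℂ)) (f : DimDrop p q) : central g * f = f * central g :=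
  DimDrop.ext fun s => by
    rw [central_mul_apply, DimDrop.mul_apply, central_apply, mul_smul_one]

theorem ampLeft_leftEnd [NeZero q] (f : DimDrop p q) : ampLeft (leftEnd f) = f.1 0 :=
  (leftEnd_kronecker_one f).symm

theorem ampRight_rightEnd [NeZero p] (f : DimDrop p q) : ampRight (rightEnd f) = f.1 1 :=
  (one_kronecker_rightEnd f).symm

theorem leftEnd_eq [NeZero q] {f : DimDrop p q} {a : Matrix (Fin p) (Fin p) ℂ}
    (h : ampLeft a = f.1 0) : leftEnd f = a := by
  ext i j
  simp [leftEnd, ← h, ampLeft_apply]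

theorem rightEnd_eq [NeZero p] {f : DimDrop p q} {b : Matrix (Fin q) (Fin q) ℂ}
    (h : ampRight b = f.1 1) : rightEnd f = b := by
  ext i j
  simp [rightEnd, ← h, ampRight_apply]

/-- The `*`-homomorphism `f ↦ c (f 0)`, which factors the evaluation at `0`. -/
def leftEndHom [NeZero q] : DimDrop p q →⋆ₐ[ℂ] Matrix (Fin p) (Fin p) ℂ where
  toFun := leftEnd
  map_one' := leftEnd_eq (map_one _)
  map_mul' f g := leftEnd_eq (by rw [map_mul, ampLeft_leftEnd, ampLeft_leftEnd]; rfl)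
  map_zero' := leftEnd_eq (map_zero _)
  map_add' f g := leftEnd_eq (by rw [map_add, ampLeft_leftEnd, ampLeft_leftEnd]; rfl)
  commutes' r := leftEnd_eq (AlgHomClass.commutes _ r)
  map_star' f := leftEnd_eq (by rw [map_star, ampLeft_leftEnd]; rfl)

theorem leftEndHom_apply [NeZero q] (f : DimDrop p q) : leftEndHom f = leftEnd f := rfl

/-- The `*`-homomorphism `f ↦ c (f 1)`, which factors the evaluation at `1`. -/
def rightEndHom [NeZero p] : DimDrop p q →⋆ₐ[ℂ] Matrix (Fin q) (Fin q) ℂ where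
  toFun := rightEnd
  map_one' := rightEnd_eq (map_one _)
  map_mul' f g := rightEnd_eq (by rw [map_mul, ampRight_rightEnd, ampRight_rightEnd]; rfl)
  map_zero' := rightEnd_eq (map_zero _)
  map_add' f g := rightEnd_eq (by rw [map_add, ampRight_rightEnd, ampRight_rightEnd]; rfl)
  commutes' r := rightEnd_eq (AlgHomClass.commutes _ r)
  map_star' f := rightEnd_eq (by rw [map_star, ampRight_rightEnd]; rfl)

theorem rightEndHom_apply [NeZero p] (f : DimDrop p q) : rightEndHom f = rightEnd f := rfl

/-- The function `s ↦ s` on the interval, with complex values. -/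
def coordinate : C(I, ℂ) := ⟨fun s => ((s : ℝ) : ℂ), by fun_prop⟩

theorem coordinate_apply (s : I) : coordinate s = ((s : ℝ) : ℂ) := rfl

theorem coordinate_zero : coordinate 0 = 0 := by simp [coordinate_apply]

theorem coordinate_one : coordinate 1 = 1 := by simp [coordinate_apply]

theorem coordinate_injective : Function.Injective coordinate := fun _ _ h =>
  Subtype.ext (Complex.ofReal_injective h)

theorem evalHom_surjective {x : I} (h0 : x ≠ 0) (h1 : x ≠ 1) :
    Function.Surjective (evalHom x : DimDrop p q →⋆ₐ[ℂ] _) := by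
  intro A
  have hx : coordinate x * (1 - coordinate x) ≠ 0 := by
    rw [← coordinate_one]
    exact mul_ne_zero (coordinate_zero ▸ coordinate_injective.ne h0)
      (sub_ne_zero.2 (coordinate_injective.ne h1.symm))
  refine ⟨scaled (.id ℂ _) (coordinate * (1 - coordinate))
    (isCompatible_id (by simp [coordinate_zero]) (by simp [coordinate_one]))
    ((coordinate x * (1 - coordinate x))⁻¹ • A), ?_⟩
  rw [evalHom_apply, scaled_apply]
  exact smul_inv_smul₀ hx A

theorem leftEndHom_surjective [NeZero q] :
    Function.Surjective (leftEndHom : DimDrop p q →⋆ₐ[ℂ] _) := fun a =>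
  ⟨scaled ampLeft (1 - coordinate) (isCompatible_ampLeft (by simp [coordinate_one])) a,
    leftEnd_eq (by simp [scaled_apply, coordinate_zero])⟩

theorem rightEndHom_surjective [NeZero p] :
    Function.Surjective (rightEndHom : DimDrop p q →⋆ₐ[ℂ] _) := fun b =>
  ⟨scaled ampRight coordinate (isCompatible_ampRight coordinate_zero) b,
    rightEnd_eq (by simp [scaled_apply, coordinate_one])⟩

end Elements

section Factorization

variable {X E : Type*} [TopologicalSpace X] [NormedAddCommGroup E]

/-- The square root of `‖f‖`, as a complex function. -/
def sqrtNorm (f : C(X, E)) : C(X, ℂ) := ⟨fun s => (√‖f s‖ : ℝ), by fun_prop⟩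

theorem sqrtNorm_apply (f : C(X, E)) (s : X) : sqrtNorm f s = (√‖f s‖ : ℝ) := rfl

theorem sqrtNorm_eq_zero_iff {f : C(X, E)} {s : X} : sqrtNorm f s = 0 ↔ f s = 0 := by
  rw [sqrtNorm_apply, Complex.ofReal_eq_zero, Real.sqrt_eq_zero (norm_nonneg _), norm_eq_zero]

variable [NormedSpace ℂ E]

theorem norm_inv_sqrtNorm_smul (f : C(X, E)) (s : X) : ‖(sqrtNorm f s)⁻¹ • f s‖ = √‖f s‖ := by
  rw [norm_smul, norm_inv, sqrtNorm_apply, Complex.norm_real,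
    Real.norm_of_nonneg (Real.sqrt_nonneg _), inv_mul_eq_div, Real.div_sqrt]

/-- The function `f / √‖f‖`, which vanishes where `f` does. -/
def divSqrtNorm (f : C(X, E)) : C(X, E) where
  toFun s := (sqrtNorm f s)⁻¹ • f s
  continuous_toFun := continuous_iff_continuousAt.2 fun s => by
    by_cases hs : f s = 0
    · have hlim : Tendsto (fun r => √‖f r‖) (𝓝 s) (𝓝 0) := by
        have hcont : Continuous fun r => √‖f r‖ := by fun_prop
        simpa [hs] using hcont.tendsto s
      rw [ContinuousAt, hs, smul_zero]
      exact squeeze_zero_norm (fun r => (norm_inv_sqrtNorm_smul f r).le) hlim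
    · exact ((sqrtNorm f).continuous.continuousAt.inv₀ (sqrtNorm_eq_zero_iff.not.2 hs)).smul
        f.continuous.continuousAt

theorem divSqrtNorm_apply (f : C(X, E)) (s : X) :
    divSqrtNorm f s = (sqrtNorm f s)⁻¹ • f s := rfl

theorem sqrtNorm_smul_divSqrtNorm (f : C(X, E)) (s : X) :
    sqrtNorm f s • divSqrtNorm f s = f s := by
  rw [divSqrtNorm_apply]
  by_cases hs : f s = 0
  · rw [hs, smul_zero, smul_zero]
  · exact smul_inv_smul₀ (sqrtNorm_eq_zero_iff.not.2 hs) _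

end Factorization

section CentralCharacter

variable {p q : ℕ}

theorem exists_eq_central_mul (f : DimDrop p q) :
    ∃ (g : C(I, ℂ)) (f' : DimDrop p q), f = central g * f' ∧ ∀ s, f.1 s = 0 → g s = 0 := by
  refine ⟨sqrtNorm f.1, ⟨divSqrtNorm f.1, ?_, ?_⟩, DimDrop.ext fun s => ?_,
    fun s => sqrtNorm_eq_zero_iff.2⟩
  · obtain ⟨a, ha⟩ := f.2.1
    exact ⟨_, by rw [divSqrtNorm_apply, ha, ← Matrix.smul_kronecker]⟩
  · obtain ⟨b, hb⟩ := f.2.2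
    exact ⟨_, by rw [divSqrtNorm_apply, hb, ← Matrix.kronecker_smul]⟩
  · rw [central_mul_apply]
    exact (sqrtNorm_smul_divSqrtNorm f.1 s).symm

/-- The self-adjoint central element `s ↦ s • 1`. -/
def position : DimDrop p q := central coordinate

theorem star_coordinate : star coordinate = coordinate :=
  ContinuousMap.ext fun s => Complex.conj_ofReal s

theorem position_mul_comm (f : DimDrop p q) : position * f = f * position :=
  central_mul_comm _ f

theorem star_position : star (position : DimDrop p q) = position := by
  rw [position, ← map_star, star_coordinate]

open scoped CStarAlgebra in
theorem map_eq_algebraMap_of_map_coordinate {B : Type*} [CStarAlgebra B]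
    (φ : C(I, ℂ) →⋆ₐ[ℂ] B) {x : I} (hx : φ coordinate = algebraMap ℂ B (coordinate x))
    (g : C(I, ℂ)) : φ g = algebraMap ℂ B (g x) := by
  let χ : C(I, ℂ) →⋆ₐ[ℂ] B :=
    { (Algebra.ofId ℂ B).comp (ContinuousMap.evalAlgHom ℂ ℂ x) with
      map_star' := fun h => algebraMap_star_comm (h x) }
  have hclosed : IsClosed (StarAlgHom.equalizer φ χ : Set C(I, ℂ)) :=
    isClosed_eq (map_continuous φ) (map_continuous χ)
  have hsep : (StarAlgHom.equalizer φ χ).SeparatesPoints := fun s t hst =>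
    ⟨coordinate, ⟨coordinate, hx, rfl⟩, coordinate_injective.ne hst⟩
  have htop := ContinuousMap.starSubalgebra_topologicalClosure_eq_top_of_separatesPoints _ hsep
  have hg : g ∈ (StarAlgHom.equalizer φ χ).topologicalClosure := htop ▸ trivial
  exact StarSubalgebra.topologicalClosure_minimal le_rfl hclosed hg

theorem map_eq_zero_of_map_position {B : Type*} [CStarAlgebra B] (Φ : DimDrop p q →⋆ₐ[ℂ] B)
    {x : I} (hx : Φ position = algebraMap ℂ B (coordinate x)) {f : DimDrop p q}
    (hf : f.1 x = 0) : Φ f = 0 := by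
  obtain ⟨g, f', rfl, hg⟩ := exists_eq_central_mul f
  have hΦg : Φ (central g) = algebraMap ℂ B (g x) :=
    map_eq_algebraMap_of_map_coordinate (Φ.comp central) hx g
  rw [map_mul, hΦg, hg x hf, map_zero, zero_mul]

end CentralCharacter

/-! ### Representations of dimension drop algebras -/

section Representations

variable {H : Type*} [NormedAddCommGroup H] [InnerProductSpace ℂ H]

section Subrepresentation

variable {𝓐 : Type*} [Semiring 𝓐] [Algebra ℂ 𝓐] [Star 𝓐] [CompleteSpace H]

/-- The restriction of a representation to an invariant subspace. -/
def subrepresentation (Φ : 𝓐 →⋆ₐ[ℂ] (H →L[ℂ] H)) (W : Submodule ℂ H)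
    [CompleteSpace W] (hW : ∀ a, ∀ v ∈ W, Φ a v ∈ W) : 𝓐 →⋆ₐ[ℂ] (W →L[ℂ] W) where
  toFun a := (Φ a).restrict (hW a)
  map_one' := by ext; simp
  map_mul' a b := by ext; simp
  map_zero' := by ext; simp
  map_add' a b := by ext; simp
  commutes' r := by ext; simp [Algebra.algebraMap_eq_smul_one]
  map_star' a := by
    rw [ContinuousLinearMap.star_eq_adjoint, ContinuousLinearMap.eq_adjoint_iff]
    intro v w
    change inner ℂ (Φ (star a) v) (w : H) = inner ℂ (v : H) (Φ a w)
    rw [map_star, ContinuousLinearMap.star_eq_adjoint, ContinuousLinearMap.adjoint_inner_left]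

end Subrepresentation

theorem exists_factorization_of_surjective {𝓐 𝓜 𝓑 : Type*} [Ring 𝓐] [StarRing 𝓐] [Algebra ℂ 𝓐]
    [Ring 𝓜] [StarRing 𝓜] [Algebra ℂ 𝓜] [Ring 𝓑] [StarRing 𝓑] [Algebra ℂ 𝓑]
    {ψ : 𝓐 →⋆ₐ[ℂ] 𝓜} (hψ : Function.Surjective ψ)
    (Φ : 𝓐 →⋆ₐ[ℂ] 𝓑) (hker : ∀ a, ψ a = 0 → Φ a = 0) :
    ∃ ρ : 𝓜 →⋆ₐ[ℂ] 𝓑, ∀ a, ρ (ψ a) = Φ a := by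
  have hcongr : ∀ {a b}, ψ a = ψ b → Φ a = Φ b := fun {a b} h =>
    sub_eq_zero.1 <| by rw [← map_sub, hker _ (by rw [map_sub, h, sub_self])]
  have hinv := Function.surjInv_eq hψ
  let ρ : 𝓜 →⋆ₐ[ℂ] 𝓑 :=
    { toFun := fun M => Φ (Function.surjInv hψ M)
      map_one' := (hcongr (by rw [hinv, map_one])).trans (map_one Φ)
      map_mul' := fun M N => (hcongr (by simp only [hinv, map_mul])).trans (map_mul Φ _ _)
      map_zero' := (hcongr (by rw [hinv, map_zero])).trans (map_zero Φ)
      map_add' := fun M N => (hcongr (by simp only [hinv, map_add])).trans (map_add Φ _ _)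
      commutes' := fun r => (hcongr (by rw [hinv, AlgHomClass.commutes])).trans
        (AlgHomClass.commutes Φ r)
      map_star' := fun M => (hcongr (by simp only [hinv, map_star])).trans (map_star Φ _) }
  exact ⟨ρ, fun a => hcongr (hinv (ψ a))⟩

theorem collectedOrthonormalBasis_apply {J : Type*} [Fintype J] [DecidableEq J]
    {V : J → Submodule ℂ H} (hV : OrthogonalFamily ℂ (fun μ => V μ) fun μ => (V μ).subtypeₗᵢ)
    (hV' : DirectSum.IsInternal V) {α : J → Type*} [∀ μ, Fintype (α μ)]
    (v : ∀ μ, OrthonormalBasis (α μ) ℂ (V μ)) (μ : J) (i : α μ) :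
    hV'.collectedOrthonormalBasis hV v ⟨μ, i⟩ = v μ i := by
  simp [DirectSum.IsInternal.collectedOrthonormalBasis]

variable {D : Type*} [Fintype D] [DecidableEq D] [FiniteDimensional ℂ H]

theorem inner_map_single_map_single (ρ : Matrix D D ℂ →⋆ₐ[ℂ] (H →L[ℂ] H)) (o i j : D) {v w : H}
    (hw : ρ (Matrix.single o o 1) w = w) :
    inner ℂ (ρ (Matrix.single i o 1) v) (ρ (Matrix.single j o 1) w) =
      if i = j then inner ℂ v w else 0 := by
  rw [← ContinuousLinearMap.adjoint_inner_right, ← ContinuousLinearMap.star_eq_adjoint,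
    ← map_star, ← mul_apply_eq_comp, ← map_mul, Matrix.star_eq_conjTranspose,
    Matrix.conjTranspose_single, star_one]
  split_ifs with hij
  · rw [hij, Matrix.single_mul_single_same, one_mul, hw]
  · rw [Matrix.single_mul_single_of_ne _ _ _ _ hij, map_zero, zero_apply, inner_zero_right]

theorem sum_map_single_map_single (ρ : Matrix D D ℂ →⋆ₐ[ℂ] (H →L[ℂ] H)) (o : D) (v : H) :
    ∑ i, ρ (Matrix.single i o 1) (ρ (Matrix.single o i 1) v) = v := by
  simp only [← mul_apply_eq_comp, ← map_mul, Matrix.single_mul_single_same, one_mul,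
    ← sum_apply, ← map_sum, Matrix.sum_single_one, map_one]
  rfl

theorem mul_single_one {d : Type*} [Fintype d] [DecidableEq d] (M : Matrix d d ℂ) (i o : d) :
    M * Matrix.single i o 1 = ∑ k, M k i • Matrix.single k o 1 := by
  ext a c
  rcases eq_or_ne c o with rfl | hc
  · simp [Matrix.sum_apply, Matrix.single_apply]
  · simp [Matrix.sum_apply, Matrix.mul_single_apply_of_ne, hc, hc.symm]

theorem exists_orthonormalBasis_of_matrix [Nonempty D] (ρ : Matrix D D ℂ →⋆ₐ[ℂ] (H →L[ℂ] H)) :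
    ∃ (m : ℕ) (u : OrthonormalBasis (Fin m × D) ℂ H),
      ∀ M j i, ρ M (u (j, i)) = ∑ k, M k i • u (j, k) := by
  obtain ⟨o⟩ := ‹Nonempty D›
  let E : D → D → H →L[ℂ] H := fun i j => ρ (Matrix.single i j 1)
  let F : Submodule ℂ H := LinearMap.eqLocus (E o o).toLinearMap LinearMap.id
  let b := stdOrthonormalBasis ℂ F
  have hb : ∀ j, E o o (b j) = b j := fun j => (b j).2
  have horth : Orthonormal ℂ fun ji : Fin (Module.finrank ℂ F) × D => E ji.2 o (b ji.1) := by
    rw [orthonormal_iff_ite]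
    rintro ⟨j, i⟩ ⟨j', i'⟩
    have hjj' := orthonormal_iff_ite.1 b.orthonormal j j'
    rw [Submodule.coe_inner] at hjj'
    change inner ℂ (E i o (b j)) (E i' o (b j')) = _
    rw [inner_map_single_map_single ρ o i i' (hb j'), hjj']
    simp only [Prod.mk.injEq, ← ite_and, and_comm]
  have hspan : ⊤ ≤ Submodule.span ℂ
      (Set.range fun ji : Fin (Module.finrank ℂ F) × D => E ji.2 o (b ji.1)) := by
    intro v _
    have hF : ∀ i, E o i v ∈ F := fun i => by
      change E o o (E o i v) = E o i v
      rw [← mul_apply_eq_comp, ← map_mul, Matrix.single_mul_single_same, one_mul]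
    rw [← sum_map_single_map_single ρ o v]
    refine Submodule.sum_mem _ fun i _ => ?_
    change E i o (⟨E o i v, hF i⟩ : F) ∈ _
    rw [← b.sum_repr ⟨_, hF i⟩, Submodule.coe_sum, map_sum]
    refine Submodule.sum_mem _ fun j _ => ?_
    rw [Submodule.coe_smul, map_smul]
    exact Submodule.smul_mem _ _ (Submodule.subset_span ⟨(j, i), rfl⟩)
  refine ⟨_, OrthonormalBasis.mk horth hspan, fun M j i => ?_⟩
  simp only [OrthonormalBasis.coe_mk]
  change ρ M (E i o (b j)) = ∑ k, M k i • E k o (b j)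
  rw [← mul_apply_eq_comp, ← map_mul, mul_single_one]
  simp only [map_sum, map_smul, sum_apply, smul_apply, E]

end Representations

section EigenspacesOfPosition

variable {p q : ℕ} {H : Type*} [NormedAddCommGroup H] [InnerProductSpace ℂ H] [CompleteSpace H]
  {Φ : DimDrop p q →⋆ₐ[ℂ] (H →L[ℂ] H)}

theorem exists_basis_of_map_position [FiniteDimensional ℂ H] {y : I}
    (hy : Φ position = algebraMap ℂ (H →L[ℂ] H) (coordinate y)) {D : Type*} [Fintype D]
    [DecidableEq D] [Nonempty D] {ψ : DimDrop p q →⋆ₐ[ℂ] Matrix D D ℂ}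
    (hψ : Function.Surjective ψ) (hker : ∀ f, ψ f = 0 → f.1 y = 0) :
    ∃ (m : ℕ) (u : OrthonormalBasis (Fin m × D) ℂ H),
      ∀ f j i, Φ f (u (j, i)) = ∑ r, ψ f r i • u (j, r) := by
  obtain ⟨ρ, hρ⟩ := exists_factorization_of_surjective hψ Φ fun f hf =>
    map_eq_zero_of_map_position Φ hy (hker f hf)
  obtain ⟨m, u, hu⟩ := exists_orthonormalBasis_of_matrix ρ
  exact ⟨m, u, fun f j i => by rw [← hρ, hu]⟩

theorem isSymmetric_map_position : (Φ position).toLinearMap.IsSymmetric :=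
  ContinuousLinearMap.isSelfAdjoint_iff_isSymmetric.1
    ((map_star Φ position).symm.trans (congrArg Φ star_position))

theorem map_mem_eigenspace_position {z : ℂ} (f : DimDrop p q) {v : H}
    (hv : v ∈ Module.End.eigenspace (Φ position).toLinearMap z) :
    Φ f v ∈ Module.End.eigenspace (Φ position).toLinearMap z := by
  rw [Module.End.mem_eigenspace_iff, ContinuousLinearMap.coe_coe] at hv ⊢
  rw [← mul_apply_eq_comp, ← map_mul, position_mul_comm, map_mul, mul_apply_eq_comp, hv, map_smul]

theorem exists_coordinate_eq_of_hasEigenvalue {z : ℂ}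
    (hz : Module.End.HasEigenvalue (Φ position).toLinearMap z) : ∃ y, coordinate y = z := by
  let toEnd : (H →L[ℂ] H) →ₐ[ℂ] Module.End ℂ H :=
    { ContinuousLinearMap.toLinearMapRingHom with commutes' := fun _ => rfl }
  have hmem : z ∈ spectrum ℂ coordinate :=
    AlgHom.spectrum_apply_subset (toEnd.comp (Φ.comp central).toAlgHom) _ hz.mem_spectrum
  rwa [ContinuousMap.spectrum_eq_range] at hmem

end EigenspacesOfPosition

section BlockBases

variable {p q : ℕ} [NeZero p] [NeZero q]
variable {H : Type*} [NormedAddCommGroup H] [InnerProductSpace ℂ H] [CompleteSpace H]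
variable {A K B : Type*} [Fintype A] [Fintype K] [Fintype B]

/-- An orthonormal basis in which the representation `Φ` of the dimension drop algebra is block
diagonal, with blocks `c (f 0)` indexed by `A`, `f (x k)` indexed by `k : K`, and `c (f 1)` indexed
by `B`. -/
structure IsBlockBasis (Φ : DimDrop p q →⋆ₐ[ℂ] (H →L[ℂ] H)) (x : K → I)
    (u : OrthonormalBasis (((A × Fin p) ⊕ (K × (Fin p × Fin q))) ⊕ (B × Fin q)) ℂ H) : Prop where
  left : ∀ f j i, Φ f (u (.inl (.inl (j, i)))) = ∑ r, leftEnd f r i • u (.inl (.inl (j, r)))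
  inner : ∀ f j i, Φ f (u (.inl (.inr (j, i)))) = ∑ r, f.1 (x j) r i • u (.inl (.inr (j, r)))
  right : ∀ f j i, Φ f (u (.inr (j, i))) = ∑ r, rightEnd f r i • u (.inr (j, r))

variable {Φ : DimDrop p q →⋆ₐ[ℂ] (H →L[ℂ] H)} {x : K → I}
  {u : OrthonormalBasis (((A × Fin p) ⊕ (K × (Fin p × Fin q))) ⊕ (B × Fin q)) ℂ H}

theorem IsBlockBasis.rename {A' K' B' : Type*} [Fintype A'] [Fintype K'] [Fintype B']
    (h : IsBlockBasis Φ x u) (eA : A ≃ A') (eK : K ≃ K') (eB : B ≃ B') :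
    IsBlockBasis Φ (x ∘ eK.symm) (u.reindex (((eA.prodCongr (.refl _)).sumCongr
      (eK.prodCongr (.refl _))).sumCongr (eB.prodCongr (.refl _)))) where
  left f j i := by simpa using h.left f (eA.symm j) i
  inner f j i := by simpa using h.inner f (eK.symm j) i
  right f j i := by simpa using h.right f (eB.symm j) i

theorem exists_isBlockBasis_of_map_position [FiniteDimensional ℂ H] {y : I}
    (hy : Φ position = algebraMap ℂ (H →L[ℂ] H) (coordinate y)) :
    ∃ (a k b : ℕ) (u : OrthonormalBasis
      (((Fin a × Fin p) ⊕ (Fin k × (Fin p × Fin q))) ⊕ (Fin b × Fin q)) ℂ H),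
      IsBlockBasis Φ (fun _ => y) u := by
  by_cases h0 : y = 0
  · obtain ⟨m, u, hu⟩ := exists_basis_of_map_position hy leftEndHom_surjective fun f hf => by
      rw [h0, ← ampLeft_leftEnd, ← leftEndHom_apply, hf, map_zero]
    refine ⟨m, 0, 0, u.reindex ((Equiv.sumEmpty _ _).trans (Equiv.sumEmpty _ _)).symm, ?_⟩
    exact ⟨fun f j i => by simpa [leftEndHom_apply] using hu f j i, fun _ j => j.elim0,
      fun _ j => j.elim0⟩
  by_cases h1 : y = 1
  · obtain ⟨m, u, hu⟩ := exists_basis_of_map_position hy rightEndHom_surjective fun f hf => by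
      rw [h1, ← ampRight_rightEnd, ← rightEndHom_apply, hf, map_zero]
    refine ⟨0, 0, m, u.reindex (Equiv.emptySum _ _).symm, ?_⟩
    exact ⟨fun _ j => j.elim0, fun _ j => j.elim0,
      fun f j i => by simpa [rightEndHom_apply] using hu f j i⟩
  obtain ⟨m, u, hu⟩ := exists_basis_of_map_position hy (evalHom_surjective h0 h1) fun _ hf => hf
  refine ⟨0, m, 0, u.reindex ((Equiv.sumEmpty _ _).trans (Equiv.emptySum _ _)).symm, ?_⟩
  exact ⟨fun _ j => j.elim0, fun f j i => by simpa [evalHom_apply] using hu f j i,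
    fun _ j => j.elim0⟩

section DirectSum

variable {J : Type*} {P R Q : Type*}

/-- A disjoint union of index sets of block diagonal matrices, with the blocks of each kind
brought together. -/
def sigmaBlockEquiv (A K B : J → Type*) (P R Q : Type*) :
    (Σ μ, ((A μ × P) ⊕ (K μ × R)) ⊕ (B μ × Q)) ≃
      (((Σ μ, A μ) × P) ⊕ ((Σ μ, K μ) × R)) ⊕ ((Σ μ, B μ) × Q) :=
  (Equiv.sigmaSumDistrib _ _).trans <|
    ((Equiv.sigmaSumDistrib _ _).trans <|
      (Equiv.sigmaProdDistrib A P).symm.sumCongr (Equiv.sigmaProdDistrib K R).symm).sumCongr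
        (Equiv.sigmaProdDistrib B Q).symm

variable [DecidableEq J] {V : J → Submodule ℂ H}

theorem isBlockBasis_collectedOrthonormalBasis [Fintype J] [∀ μ, CompleteSpace (V μ)]
    (horth : OrthogonalFamily ℂ (fun μ => V μ) fun μ => (V μ).subtypeₗᵢ)
    (hinternal : DirectSum.IsInternal V)
    {Ψ : ∀ μ, DimDrop p q →⋆ₐ[ℂ] (V μ →L[ℂ] V μ)} (hΨ : ∀ μ f v, (Ψ μ f v : H) = Φ f v)
    {A K B : J → Type*} [∀ μ, Fintype (A μ)] [∀ μ, Fintype (K μ)] [∀ μ, Fintype (B μ)]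
    {x : ∀ μ, K μ → I}
    {u : ∀ μ, OrthonormalBasis
      (((A μ × Fin p) ⊕ (K μ × (Fin p × Fin q))) ⊕ (B μ × Fin q)) ℂ (V μ)}
    (hu : ∀ μ, IsBlockBasis (Ψ μ) (x μ) (u μ)) :
    IsBlockBasis Φ (fun j : Σ μ, K μ => x j.1 j.2)
      ((hinternal.collectedOrthonormalBasis horth u).reindex
        (sigmaBlockEquiv A K B (Fin p) (Fin p × Fin q) (Fin q))) where
  left f j i := by
    have h := congrArg ((↑) : V j.1 → H) ((hu j.1).left f j.2 i)
    simpa [sigmaBlockEquiv, Sigma.map, collectedOrthonormalBasis_apply, hΨ] using h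
  inner f j i := by
    have h := congrArg ((↑) : V j.1 → H) ((hu j.1).inner f j.2 i)
    simpa [sigmaBlockEquiv, Sigma.map, collectedOrthonormalBasis_apply, hΨ] using h
  right f j i := by
    have h := congrArg ((↑) : V j.1 → H) ((hu j.1).right f j.2 i)
    simpa [sigmaBlockEquiv, Sigma.map, collectedOrthonormalBasis_apply, hΨ] using h

theorem exists_isBlockBasis_of_isInternal [Finite J] [FiniteDimensional ℂ H]
    (horth : OrthogonalFamily ℂ (fun μ => V μ) fun μ => (V μ).subtypeₗᵢ)
    (hinternal : DirectSum.IsInternal V)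
    (hΦ : ∀ μ f, ∀ v ∈ V μ, Φ f v ∈ V μ)
    (hscalar : ∀ μ, ∃ y, ∀ v ∈ V μ, Φ position v = coordinate y • v) :
    ∃ (a k b : ℕ) (x : Fin k → I) (u : OrthonormalBasis
      (((Fin a × Fin p) ⊕ (Fin k × (Fin p × Fin q))) ⊕ (Fin b × Fin q)) ℂ H),
      IsBlockBasis Φ x u := by
  cases nonempty_fintype J
  choose y hy using hscalar
  have hΨ μ : subrepresentation Φ (V μ) (hΦ μ) position = algebraMap ℂ _ (coordinate (y μ)) := by
    ext v
    exact hy μ v v.2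
  choose a k b u hu using fun μ => exists_isBlockBasis_of_map_position (hΨ μ)
  have h := isBlockBasis_collectedOrthonormalBasis horth hinternal (fun _ _ _ => rfl) hu
  exact ⟨_, _, _, _, _, h.rename (Fintype.equivFin _) (Fintype.equivFin _) (Fintype.equivFin _)⟩

end DirectSum

theorem exists_isBlockBasis [FiniteDimensional ℂ H] (Φ : DimDrop p q →⋆ₐ[ℂ] (H →L[ℂ] H)) :
    ∃ (a k b : ℕ) (x : Fin k → I) (u : OrthonormalBasis
      (((Fin a × Fin p) ⊕ (Fin k × (Fin p × Fin q))) ⊕ (Fin b × Fin q)) ℂ H),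
      IsBlockBasis Φ x u := by
  classical
  have hΦ : (Φ position).toLinearMap.IsSymmetric := isSymmetric_map_position
  refine exists_isBlockBasis_of_isInternal hΦ.orthogonalFamily_eigenspaces'
    hΦ.direct_sum_isInternal (fun _ f _ => map_mem_eigenspace_position f) fun μ => ?_
  obtain ⟨y, hy⟩ := exists_coordinate_eq_of_hasEigenvalue μ.2
  exact ⟨y, fun v hv => hy ▸ Module.End.mem_eigenspace_iff.1 hv⟩

/-- The identifications `f 0 ≅ c (f 0) ⊕ ⋯ ⊕ c (f 0)` and `f 1 ≅ c (f 1) ⊕ ⋯ ⊕ c (f 1)`, for blocks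
`f 0` indexed by `K₀` and blocks `f 1` indexed by `K₁`. -/
def regroupEquiv (p q : ℕ) (A B K K₀ K₁ : Type*) :
    (((A ⊕ K₀ × Fin q) × Fin p) ⊕ (K × (Fin p × Fin q))) ⊕ ((B ⊕ K₁ × Fin p) × Fin q) ≃
      ((A × Fin p) ⊕ ((K ⊕ K₀ ⊕ K₁) × (Fin p × Fin q))) ⊕ (B × Fin q) where
  toFun
    | .inl (.inl (.inl a, i)) => .inl (.inl (a, i))
    | .inl (.inr (k, ij)) => .inl (.inr (.inl k, ij))
    | .inl (.inl (.inr (k, j), i)) => .inl (.inr (.inr (.inl k), (i, j)))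
    | .inr (.inr (k, i), j) => .inl (.inr (.inr (.inr k), (i, j)))
    | .inr (.inl b, j) => .inr (b, j)
  invFun
    | .inl (.inl (a, i)) => .inl (.inl (.inl a, i))
    | .inl (.inr (.inl k, ij)) => .inl (.inr (k, ij))
    | .inl (.inr (.inr (.inl k), (i, j))) => .inl (.inl (.inr (k, j), i))
    | .inl (.inr (.inr (.inr k), (i, j))) => .inr (.inr (k, i), j)
    | .inr (b, j) => .inr (.inl b, j)
  left_inv := by
    rintro ((⟨a | ⟨k, j⟩, i⟩ | ⟨k, i, j⟩) | ⟨b | ⟨k, i⟩, j⟩) <;> rfl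
  right_inv := by
    rintro ((⟨a, i⟩ | ⟨k | k | k, i, j⟩) | ⟨b, j⟩) <;> rfl

theorem IsBlockBasis.regroup {K₀ K₁ : Type*} [Fintype K₀] [Fintype K₁]
    {u : OrthonormalBasis ((((A ⊕ K₀ × Fin q) × Fin p) ⊕ (K × (Fin p × Fin q))) ⊕
      ((B ⊕ K₁ × Fin p) × Fin q)) ℂ H} (h : IsBlockBasis Φ x u) :
    IsBlockBasis Φ (Sum.elim x (Sum.elim (fun _ : K₀ => 0) fun _ : K₁ => 1))
      (u.reindex (regroupEquiv p q A B K K₀ K₁)) where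
  left f j i := by simpa [regroupEquiv] using h.left f (.inl j) i
  inner f := by
    rintro (j | j | j) ⟨i, i'⟩
    · simpa [regroupEquiv] using h.inner f j (i, i')
    · simpa [regroupEquiv, ← ampLeft_leftEnd, ampLeft_apply, Matrix.one_apply,
        Fintype.sum_prod_type] using h.left f (.inr (j, i')) i
    · simpa [regroupEquiv, ← ampRight_rightEnd, ampRight_apply, Matrix.one_apply,
        Fintype.sum_prod_type] using h.right f (.inr (j, i)) i'
  right f j i := by simpa [regroupEquiv] using h.right f (.inl j) i

theorem exists_sorted_isBlockBasis [FiniteDimensional ℂ H]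
    (Φ : DimDrop p q →⋆ₐ[ℂ] (H →L[ℂ] H)) :
    ∃ (a k b : ℕ) (x : Fin k → I) (u : OrthonormalBasis (BlockIndex p q a k b) ℂ H),
      a < q ∧ b < p ∧ Monotone x ∧ IsBlockBasis Φ x u := by
  obtain ⟨a, k, b, x, u, h⟩ := exists_isBlockBasis Φ
  have eA : Fin a ≃ Fin (a % q) ⊕ Fin (a / q) × Fin q :=
    Fintype.equivOfCardEq (by simp [Nat.mod_add_div'])
  have eB : Fin b ≃ Fin (b % p) ⊕ Fin (b / p) × Fin p :=
    Fintype.equivOfCardEq (by simp [Nat.mod_add_div'])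
  have h' := ((h.rename eA (.refl _) eB).regroup.rename (.refl _) (Fintype.equivFin _) (.refl _))
  exact ⟨_, _, _, _, _, Nat.mod_lt _ (NeZero.pos q), Nat.mod_lt _ (NeZero.pos p),
    Tuple.monotone_sort _, h'.rename (.refl _) (Tuple.sort _).symm (.refl _)⟩

theorem IsBlockBasis.apply_eq_sum {a k b : ℕ} {x : Fin k → I}
    {u : OrthonormalBasis (BlockIndex p q a k b) ℂ H} (h : IsBlockBasis Φ x u) (f : DimDrop p q)
    (c : BlockIndex p q a k b) :
    Φ f (u c) = ∑ r, patternMatrix a b (fun i => .const I (x i)) f 0 r c • u r := by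
  rcases c with (⟨j, i⟩ | ⟨j, i⟩) | ⟨j, i⟩
  · simp [h.left, patternMatrix, Matrix.one_apply, ite_smul, Fintype.sum_sum_type,
      Fintype.sum_prod_type (α₁ := Fin a), Finset.sum_ite_irrel]
  · simp [h.inner, patternMatrix, ite_smul, Fintype.sum_sum_type,
      Fintype.sum_prod_type (α₁ := Fin k), Finset.sum_ite_irrel]
  · simp [h.right, patternMatrix, Matrix.one_apply, ite_smul, Fintype.sum_sum_type,
      Fintype.sum_prod_type (α₁ := Fin b), Finset.sum_ite_irrel]

end BlockBases

/-! ### Eigenvalue patterns -/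

section SortedTuples

variable {α : Type*} [TopologicalSpace α] [LinearOrder α] {k : ℕ}

theorem eq_of_monotone_of_forall_sum_eq [NormalSpace α] [T1Space α] {z w : Fin k → α}
    (hz : Monotone z) (hw : Monotone w) (h : ∀ g : C(α, ℝ), ∑ i, g (z i) = ∑ i, g (w i)) :
    z = w := by
  classical
  have hcount (c : α) : (List.ofFn z).count c = (List.ofFn w).count c := by
    obtain ⟨g, hg0, hg1, -⟩ := exists_continuous_zero_one_of_isClosed
      (s := ((Set.range z ∪ Set.range w) \ {c} : Set α)) (t := {c})
      (((Set.finite_range z).union (Set.finite_range w)).sdiff.isClosed) isClosed_singleton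
      Set.disjoint_sdiff_left
    have key (y : Fin k → α) (hy : Set.range y ⊆ Set.range z ∪ Set.range w) :
        ((List.ofFn y).count c : ℝ) = ∑ i, g (y i) := by
      have hgy i : g (y i) = if c = y i then 1 else 0 := by
        split_ifs with hc
        · exact hg1 hc.symm
        · exact hg0 ⟨hy ⟨i, rfl⟩, fun h' => hc h'.symm⟩
      rw [← Multiset.coe_count, ← Fin.univ_val_map, Multiset.count_map, Finset.sum_congr rfl
        fun i _ => hgy i, Finset.sum_boole]
      rfl
    exact_mod_cast (key z Set.subset_union_left).trans
      ((h g).trans (key w Set.subset_union_right).symm)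
  exact List.ofFn_injective (List.Perm.eq_of_sortedLE hz.sortedLE_ofFn
    hw.sortedLE_ofFn (List.perm_iff_count.2 hcount))

theorem continuous_of_continuous_sum [OrderClosedTopology α] [CompactSpace α]
    {X : Type*} [TopologicalSpace X] {y : X → Fin k → α} (hy : ∀ s, Monotone (y s))
    (hc : ∀ g : C(α, ℝ), Continuous fun s => ∑ i, g (y s i)) : Continuous y := by
  let F (z : {z : Fin k → α // Monotone z}) (g : C(α, ℝ)) : ℝ := ∑ i, g (z.1 i)
  have : CompactSpace {z : Fin k → α // Monotone z} :=
    isCompact_iff_compactSpace.1 isClosed_monotone.isCompact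
  have hF : Topology.IsClosedEmbedding F := by
    refine Continuous.isClosedEmbedding (continuous_pi fun g => continuous_finsetSum _ fun i _ =>
        g.continuous.comp ((continuous_apply i).comp continuous_subtype_val))
      fun z w h => Subtype.ext ?_
    exact eq_of_monotone_of_forall_sum_eq z.2 w.2 (congrFun h)
  have hy' : Continuous fun s => (⟨y s, hy s⟩ : {z : Fin k → α // Monotone z}) :=
    hF.continuous_iff.2 (continuous_pi hc)
  exact continuous_subtype_val.comp hy'

end SortedTuples

section PatternExistence

theorem trace_reindex {m n R : Type*} [Fintype m] [Fintype n] [AddCommMonoid R] (e : m ≃ n)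
    (M : Matrix m m R) : (Matrix.reindex e e M).trace = M.trace :=
  e.symm.sum_comp fun i => M i i

/-- A real function on the interval, as a complex one. -/
def complexify (g : C(I, ℝ)) : C(I, ℂ) := ⟨fun s => (g s : ℂ), by fun_prop⟩

theorem complexify_apply (g : C(I, ℝ)) (s : I) : complexify g s = g s := rfl

variable {p q : ℕ}

theorem leftEnd_central [NeZero q] (g : C(I, ℂ)) :
    leftEnd (central g : DimDrop p q) = g 0 • 1 :=
  leftEnd_eq (by rw [central_apply, map_smul, map_one])

theorem rightEnd_central [NeZero p] (g : C(I, ℂ)) :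
    rightEnd (central g : DimDrop p q) = g 1 • 1 :=
  rightEnd_eq (by rw [central_apply, map_smul, map_one ampRight])

theorem trace_patternMatrix_central [NeZero p] [NeZero q] {a b k : ℕ} (t : Fin k → C(I, I))
    (g : C(I, ℂ)) (s : I) :
    (patternMatrix a b t (central g : DimDrop p q) s).trace =
      (a * p) * g 0 + (p * q) * ∑ i, g (t i s) + (b * q) * g 1 := by
  simp only [Matrix.trace, Fintype.sum_sum_type, Fintype.sum_prod_type, Matrix.diag_apply]
  simp [patternMatrix, leftEnd_central, rightEnd_central, central_apply, Finset.mul_sum]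
  ring_nf

theorem dimension_eq_of_orthonormalBasis {n : Type*} [Fintype n] {a b k : ℕ}
    (u : OrthonormalBasis (BlockIndex p q a k b) ℂ (EuclideanSpace ℂ n)) :
    a * p + k * (p * q) + b * q = Fintype.card n := by
  have h := Module.finrank_eq_card_basis u.toBasis
  rw [finrank_euclideanSpace] at h
  simpa using h.symm

variable [NeZero p] [NeZero q]

theorem block_numbers_unique (hpq : p.Coprime q) {a b k a' b' k' : ℕ} (ha : a < q) (hb : b < p)
    (ha' : a' < q) (hb' : b' < p)
    (h : a * p + k * (p * q) + b * q = a' * p + k' * (p * q) + b' * q) :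
    a = a' ∧ b = b' ∧ k = k' := by
  have modq : a * p ≡ a' * p [MOD q] := by
    simpa [Nat.ModEq, ← mul_assoc] using congrArg (· % q) h
  have modp : b * q ≡ b' * q [MOD p] := by
    simpa [Nat.ModEq, mul_left_comm _ p, Nat.mul_add_mod, add_right_comm] using congrArg (· % p) h
  obtain rfl : a = a' := (modq.cancel_right_of_coprime hpq.symm).eq_of_lt_of_lt ha ha'
  obtain rfl : b = b' := (modp.cancel_right_of_coprime hpq).eq_of_lt_of_lt hb hb'
  refine ⟨rfl, rfl, Nat.eq_of_mul_eq_mul_right (Nat.mul_pos (NeZero.pos p) (NeZero.pos q)) ?_⟩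
  linarith

/-- Matrices, as operators on the Euclidean space with its standard basis. -/
def euclideanHom (n : Type*) [Fintype n] [DecidableEq n] :
    Matrix n n ℂ →⋆ₐ[ℂ] (EuclideanSpace ℂ n →L[ℂ] EuclideanSpace ℂ n) :=
  (Matrix.toEuclideanCLM (n := n) (𝕜 := ℂ)).toStarAlgHom

theorem euclideanHom_apply {n : Type*} [Fintype n] [DecidableEq n] (M : Matrix n n ℂ)
    (v : EuclideanSpace ℂ n) (r : n) : euclideanHom n M v r = ∑ c, M r c * v c := rfl

theorem IsBlockBasis.exists_unitary {n : Type*} [Fintype n] [DecidableEq n] {a b k : ℕ}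
    {φ : DimDrop p q →⋆ₐ[ℂ] Matrix n n ℂ} {x : Fin k → I}
    {u : OrthonormalBasis (BlockIndex p q a k b) ℂ (EuclideanSpace ℂ n)}
    (h : IsBlockBasis ((euclideanHom n).comp φ) x u) (e : BlockIndex p q a k b ≃ n) :
    ∃ v : Matrix.unitaryGroup n ℂ, ∀ f, φ f = (v : Matrix n n ℂ) *
      Matrix.reindex e e (patternMatrix a b (fun i => .const I (x i)) f 0) *
        star (v : Matrix n n ℂ) := by
  let V : Matrix n n ℂ := (EuclideanSpace.basisFun n ℂ).toBasis.toMatrix (u.reindex e)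
  have hV : V ∈ Matrix.unitaryGroup n ℂ :=
    OrthonormalBasis.toMatrix_orthonormalBasis_mem_unitary _ _
  have V_apply r c : V r c = u (e.symm c) r := by simp [V, Module.Basis.toMatrix_apply]
  refine ⟨⟨V, hV⟩, fun f => ?_⟩
  have intertwine : φ f * V =
      V * Matrix.reindex e e (patternMatrix a b (fun i => .const I (x i)) f 0) := by
    ext r c
    have hcol := congrArg (· r) (h.apply_eq_sum f (e.symm c))
    simp only [StarAlgHom.comp_apply, euclideanHom_apply, WithLp.ofLp_sum, WithLp.ofLp_smul,
      Finset.sum_apply, Pi.smul_apply, smul_eq_mul, ← V_apply] at hcol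
    rw [Matrix.mul_apply, hcol, Matrix.mul_apply, ← e.sum_comp]
    simp [V_apply, mul_comm]
  rw [← intertwine, mul_assoc, Matrix.mem_unitaryGroup_iff.1 hV, mul_one]

variable {p' q' : ℕ}

theorem exists_constant_size_isBlockBasis (hpq : p.Coprime q)
    {n X : Type*} [Fintype n] [Nonempty X]
    (Φ : X → DimDrop p q →⋆ₐ[ℂ] (EuclideanSpace ℂ n →L[ℂ] EuclideanSpace ℂ n)) :
    ∃ a k b : ℕ, a < q ∧ b < p ∧ a * p + k * (p * q) + b * q = Fintype.card n ∧
      ∀ s, ∃ (x : Fin k → I) (u : OrthonormalBasis (BlockIndex p q a k b) ℂ (EuclideanSpace ℂ n)),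
        Monotone x ∧ IsBlockBasis (Φ s) x u := by
  have s₀ : X := Classical.arbitrary X
  choose a k b x u ha hb hx hu using fun s => exists_sorted_isBlockBasis (Φ s)
  have hdim s := dimension_eq_of_orthonormalBasis (u s)
  refine ⟨a s₀, k s₀, b s₀, ha s₀, hb s₀, hdim s₀, fun s => ?_⟩
  obtain ⟨h1, h2, h3⟩ := block_numbers_unique hpq (ha s) (hb s) (ha s₀) (hb s₀)
    ((hdim s).trans (hdim s₀).symm)
  rw [← h1, ← h2, ← h3]
  exact ⟨x s, u s, hx s, hu s⟩

theorem exists_isNormalizedPattern (hpq : p.Coprime q) (ι : DimDrop p q →⋆ₐ[ℂ] DimDrop p' q') :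
    ∃ (k : ℕ) (t : Fin k → C(I, I)), IsNormalizedPattern ι t := by
  obtain ⟨a, k, b, ha, hb, hdim, h⟩ := exists_constant_size_isBlockBasis hpq
    fun s : I => (euclideanHom (Fin p' × Fin q')).comp ((evalHom s).comp ι)
  choose x u hx hu using h
  let e : BlockIndex p q a k b ≃ Fin p' × Fin q' := Fintype.equivOfCardEq (by simpa using hdim)
  choose v hv using fun s => (hu s).exists_unitary e
  have trace_eq (g : C(I, ℂ)) (s : I) : ((ι (central g)).1 s).trace =
      (a * p) * g 0 + (p * q) * ∑ i, g (x s i) + (b * q) * g 1 := by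
    have := hv s (central g)
    rw [StarAlgHom.comp_apply, evalHom_apply] at this
    rw [this, Matrix.trace_mul_cycle, Matrix.mem_unitaryGroup_iff'.1 (v s).2, one_mul,
      trace_reindex, trace_patternMatrix_central]
    rfl
  have hcont : Continuous x := by
    refine continuous_of_continuous_sum hx fun g => ?_
    have hsum s : ∑ i, g (x s i) = ((((ι (central (complexify g))).1 s).trace -
        ((a : ℂ) * p) * g 0 - (b * q) * g 1) / (p * q)).re := by
      have hpq0 : (p : ℂ) * q ≠ 0 := by simp [NeZero.ne]
      rw [trace_eq, add_sub_right_comm]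
      simp only [complexify_apply, ← Complex.ofReal_sum]
      rw [add_sub_cancel_left, add_sub_cancel_right, mul_div_cancel_left₀ _ hpq0,
        Complex.ofReal_re]
    simp only [hsum]
    exact Complex.continuous_re.comp <| (((Continuous.matrix_trace
      (ι (central (complexify g))).1.continuous).sub continuous_const).sub
        continuous_const).div_const _
  exact ⟨k, fun i => ⟨fun s => x s i, by fun_prop⟩, ⟨a, b, ha, hb, e, v, fun f s => hv s f⟩,
    fun i j hij s => hx s hij⟩

end PatternExistence

section PatternConsequences

variable {p q : ℕ} {n : Type*} [Fintype n]

/-- The embedding of a product of copies of `M_p ⊗ M_q` as the middle blocks of the block diagonal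
matrices over `BlockIndex p q a k b`. -/
def middleBlockHom {a b k : ℕ} (e : BlockIndex p q a k b ≃ n) :
    (Fin k → Matrix (Fin p × Fin q) (Fin p × Fin q) ℂ) →⋆ₙₐ[ℂ] Matrix n n ℂ where
  toFun g := Matrix.reindex e e (Matrix.fromBlocks (Matrix.fromBlocks 0 0 0
    (Matrix.reindex (.prodComm _ _) (.prodComm _ _) (Matrix.blockDiagonal g))) 0 0 0)
  map_smul' r g := by
    ext i j
    rcases hi : e.symm i with (_ | _) | _ <;> rcases hj : e.symm j with (_ | _) | _ <;>
      simp [hi, hj, Matrix.blockDiagonal_smul]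
  map_zero' := by simp
  map_add' g g' := by
    ext i j
    rcases hi : e.symm i with (_ | _) | _ <;> rcases hj : e.symm j with (_ | _) | _ <;>
      simp [hi, hj, Matrix.blockDiagonal_add]
  map_mul' g g' := by
    simp [Pi.mul_def, Matrix.blockDiagonal_mul, Matrix.submatrix_mul_equiv,
      Matrix.fromBlocks_multiply, Matrix.submatrix_mul _ _ _ _ _ Prod.swap_bijective]
  map_star' g := by
    simp [Matrix.star_eq_conjTranspose, Matrix.fromBlocks_conjTranspose,
      Matrix.conjTranspose_submatrix, Matrix.blockDiagonal_conjTranspose, Pi.star_def]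

variable [NeZero p] [NeZero q]

theorem reindex_patternMatrix_sub {a b k : ℕ} (e : BlockIndex p q a k b ≃ n)
    (t : Fin k → C(I, I)) (f : DimDrop p q) (s s' : I) :
    Matrix.reindex e e (patternMatrix a b t f s) - Matrix.reindex e e (patternMatrix a b t f s') =
      middleBlockHom e fun i => f.1 (t i s) - f.1 (t i s') := by
  ext i j
  rcases hi : e.symm i with (_ | _) | _ <;> rcases hj : e.symm j with (_ | _) | _ <;>
    simp [hi, hj, middleBlockHom, patternMatrix, Matrix.blockDiagonal_apply, ite_sub_ite]

variable {p' q' : ℕ} {ι : DimDrop p q →⋆ₐ[ℂ] DimDrop p' q'} {a b k : ℕ} {t : Fin k → C(I, I)}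

theorem IsEigenvaluePattern.trace_eq (h : IsEigenvaluePattern ι a b t) (f : DimDrop p q) (s : I) :
    ((ι f).1 s).trace = (patternMatrix a b t f s).trace := by
  obtain ⟨-, -, e, v, hv⟩ := h
  rw [hv, Matrix.trace_mul_cycle, Matrix.mem_unitaryGroup_iff'.1 (v s).2, one_mul, trace_reindex]

theorem IsEigenvaluePattern.trace_central (h : IsEigenvaluePattern ι a b t) (g : C(I, ℂ)) (s : I) :
    ((ι (central g)).1 s).trace =
      (a * p) * g 0 + (p * q) * ∑ i, g (t i s) + (b * q) * g 1 := by
  rw [h.trace_eq, trace_patternMatrix_central]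

theorem norm_unitary_mul_mul_star {m : Type*} [Fintype m] [DecidableEq m] {u : Matrix m m ℂ}
    (hu : u ∈ Matrix.unitaryGroup m ℂ) (M : Matrix m m ℂ) : ‖u * M * star u‖ = ‖M‖ := by
  rw [CStarRing.norm_mul_mem_unitary _ (Unitary.star_mem hu), CStarRing.norm_mem_unitary_mul _ hu]

theorem conj_conj_star {R : Type*} [Monoid R] [StarMul R] {u w x : R} (hw : star w * w = 1) :
    (u * star w) * (w * x * star w) * star (u * star w) = u * x * star u := by
  calc _ = u * (star w * w) * x * (star w * w) * star u := by
        simp only [star_mul, star_star, mul_assoc]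
    _ = u * x * star u := by rw [hw, mul_one, mul_one]

theorem IsEigenvaluePattern.exists_unitary_norm_sub_le (h : IsEigenvaluePattern ι a b t)
    (f : DimDrop p q) (s s' : I) {r : ℝ} (hr : 0 ≤ r)
    (hf : ∀ i, ‖f.1 (t i s) - f.1 (t i s')‖ ≤ r) :
    ∃ u ∈ Matrix.unitaryGroup (Fin p' × Fin q') ℂ,
      ‖(ι f).1 s - u * (ι f).1 s' * star u‖ ≤ r := by
  obtain ⟨-, -, e, v, hv⟩ := h
  refine ⟨v s * star (v s'), (v s * star (v s')).2, ?_⟩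
  have hunit := Matrix.mem_unitaryGroup_iff'.1 (v s').2
  rw [Unitary.coe_star, hv f s, hv f s', conj_conj_star hunit, ← sub_mul, ← mul_sub,
    norm_unitary_mul_mul_star (v s).2, reindex_patternMatrix_sub]
  exact (NonUnitalStarAlgHom.norm_apply_le (middleBlockHom e) _).trans
    ((pi_norm_le_iff_of_nonneg hr).2 hf)

theorem norm_entry_le {m : Type*} [Fintype m] [DecidableEq m] (M : Matrix m m ℂ) (i j : m) :
    ‖M i j‖ ≤ ‖M‖ := by
  have hcol := M.l2_opNorm_mulVec (EuclideanSpace.single j 1)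
  rw [PiLp.norm_single, norm_one, mul_one] at hcol
  refine le_trans ?_ ((PiLp.norm_apply_le _ i).trans hcol)
  simp

theorem norm_trace_le {m : Type*} [Fintype m] [DecidableEq m] (M : Matrix m m ℂ) :
    ‖M.trace‖ ≤ Fintype.card m * ‖M‖ := by
  refine (norm_sum_le _ _).trans ((Finset.sum_le_sum fun i _ => norm_entry_le M i i).trans ?_)
  simp

theorem IsEigenvaluePattern.norm_apply_le_norm (h : IsEigenvaluePattern ι a b t) (g : C(I, ℂ))
    (i : Fin k) (s : I) : ‖g (t i s)‖ ≤ ‖ι (central g)‖ := by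
  obtain ⟨-, -, e, v, hv⟩ := h
  let c : BlockIndex p q a k b := .inl (.inr (i, (0, 0)))
  have entry_eq : Matrix.reindex e e (patternMatrix a b t (central g) s) (e c) (e c) =
      g (t i s) := by
    simp [c, patternMatrix, central_apply]
  calc ‖g (t i s)‖ ≤ ‖Matrix.reindex e e (patternMatrix a b t (central g) s)‖ :=
        entry_eq ▸ norm_entry_le _ _ _
    _ = ‖(ι (central g)).1 s‖ := by rw [hv, norm_unitary_mul_mul_star (v s).2]
    _ ≤ ‖ι (central g)‖ := DimDrop.norm_apply_le _ s

end PatternConsequences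

/-! ### Tracial states -/

theorem eq_trace_div_card_mul {K n : Type*} [Field K] [CharZero K] [Fintype n] [DecidableEq n]
    [Nonempty n] {L : Matrix n n K →ₗ[K] K} (hL : ∀ A B, L (A * B) = L (B * A))
    (A : Matrix n n K) : L A = A.trace / Fintype.card n * L 1 := by
  obtain ⟨o⟩ := ‹Nonempty n›
  have apply_single (i j : n) : L (Matrix.single i j 1) =
      L (Matrix.single o o 1) * (Matrix.single i j (1 : K)).trace := by
    have hmul : Matrix.single i j (1 : K) = Matrix.single i o 1 * Matrix.single o j 1 := by
      rw [Matrix.single_mul_single_same, mul_one]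
    rcases eq_or_ne i j with rfl | hij
    · rw [hmul, hL, Matrix.single_mul_single_same, Matrix.single_mul_single_same,
        Matrix.trace_single_eq_same, mul_one, mul_one]
    · rw [hmul, hL, Matrix.single_mul_single_of_ne _ _ _ _ hij.symm, map_zero, ← hmul,
        Matrix.trace_single_eq_of_ne _ _ _ hij, mul_zero]
  have eq_smul_trace : L = L (Matrix.single o o 1) • Matrix.traceLinearMap n K K :=
    Matrix.ext_linearMap K fun i j => LinearMap.ext_ring (apply_single i j)
  have hn : (Fintype.card n : K) ≠ 0 := Nat.cast_ne_zero.2 (Fintype.card_pos_iff.2 ⟨o⟩).ne'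
  rw [eq_smul_trace]
  simp only [LinearMap.smul_apply, Matrix.traceLinearMap_apply, Matrix.trace_one, smul_eq_mul]
  field_simp

theorem trace_algHom_apply {K m n : Type*} [Field K] [CharZero K] [Fintype m] [DecidableEq m]
    [Fintype n] [DecidableEq n] [Nonempty n] (φ : Matrix n n K →ₐ[K] Matrix m m K)
    (A : Matrix n n K) : (φ A).trace = A.trace / Fintype.card n * Fintype.card m := by
  rw [← Matrix.trace_one (n := m), ← map_one φ]
  refine eq_trace_div_card_mul (L := Matrix.traceLinearMap m K K ∘ₗ φ.toLinearMap)
    (fun A B => ?_) A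
  simpa only [map_mul, LinearMap.comp_apply, AlgHom.toLinearMap_apply] using!
    Matrix.trace_mul_comm (φ A) (φ B)

section NormalizedTrace

variable {p q : ℕ}

/-- The normalized trace of the values, a function on the interval. -/
def normTrace : DimDrop p q →ₗ[ℂ] C(I, ℂ) where
  toFun f := ⟨fun s => (f.1 s).trace / (p * q),
    (Continuous.matrix_trace f.1.continuous).div_const _⟩
  map_add' f g := ContinuousMap.ext fun s => by
    simp [Matrix.trace_add, add_div]
  map_smul' r f := ContinuousMap.ext fun s => by
    simp [Matrix.trace_smul, mul_div_assoc]

theorem normTrace_apply (f : DimDrop p q) (s : I) :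
    normTrace f s = (f.1 s).trace / (p * q) := rfl

theorem normTrace_mul_comm (f g : DimDrop p q) : normTrace (f * g) = normTrace (g * f) :=
  ContinuousMap.ext fun s => by
    rw [normTrace_apply, DimDrop.mul_apply, Matrix.trace_mul_comm]; rfl

open scoped ComplexOrder in
theorem normTrace_star_mul_self_nonneg (f : DimDrop p q) (s : I) :
    0 ≤ normTrace (star f * f) s := by
  rw [normTrace_apply, DimDrop.mul_apply, DimDrop.star_apply]
  refine div_nonneg (Matrix.posSemidef_conjTranspose_mul_self (f.1 s)).trace_nonneg ?_
  exact_mod_cast Nat.zero_le (p * q)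

variable [NeZero p] [NeZero q]

theorem normTrace_one : normTrace (1 : DimDrop p q) = 1 := ContinuousMap.ext fun s => by
  have hp : (p : ℂ) ≠ 0 := NeZero.ne _
  have hq : (q : ℂ) ≠ 0 := NeZero.ne _
  rw [normTrace_apply, DimDrop.one_apply, Matrix.trace_one, Fintype.card_prod, Fintype.card_fin,
    Fintype.card_fin, Nat.cast_mul, div_self (mul_ne_zero hp hq), ContinuousMap.one_apply]

theorem norm_trace_div_le (M : Matrix (Fin p × Fin q) (Fin p × Fin q) ℂ) :
    ‖M.trace / (p * q)‖ ≤ ‖M‖ := by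
  have h := norm_trace_le M
  rw [Fintype.card_prod, Fintype.card_fin, Fintype.card_fin, Nat.cast_mul] at h
  have hpq : (0 : ℝ) < p * q := by exact_mod_cast Nat.mul_pos (NeZero.pos p) (NeZero.pos q)
  rwa [norm_div, norm_mul, Complex.norm_natCast, Complex.norm_natCast, div_le_iff₀' hpq]

theorem norm_normTrace_le (f : DimDrop p q) (s : I) : ‖normTrace f s‖ ≤ ‖f‖ :=
  (norm_trace_div_le _).trans (f.norm_apply_le s)

theorem norm_normTrace_sub_normTrace_le {f : DimDrop p q} {s s' : I}
    {u : Matrix (Fin p × Fin q) (Fin p × Fin q) ℂ}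
    (hu : u ∈ Matrix.unitaryGroup (Fin p × Fin q) ℂ) :
    ‖normTrace f s - normTrace f s'‖ ≤ ‖f.1 s - u * f.1 s' * star u‖ := by
  have htrace : (u * f.1 s' * star u).trace = (f.1 s').trace := by
    rw [Matrix.trace_mul_cycle, (Matrix.mem_unitaryGroup_iff').1 hu, one_mul]
  rw [normTrace_apply, normTrace_apply, ← sub_div, ← htrace, ← Matrix.trace_sub]
  exact norm_trace_div_le _

end NormalizedTrace

section TracialFunctionals

variable {p q : ℕ} {d : Type*} [Fintype d] [DecidableEq d]
  {ψ : Matrix d d ℂ →⋆ₐ[ℂ] Matrix (Fin p × Fin q) (Fin p × Fin q) ℂ} {g h : C(I, ℂ)}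

theorem IsCompatible.of_eq_zero_imp (hg : IsCompatible ψ g) (h0 : ∀ s, g s = 0 → h s = 0) :
    IsCompatible ψ h :=
  ⟨hg.left.imp_left (h0 0), hg.right.imp_left (h0 1)⟩

theorem scaled_one (hg : IsCompatible ψ g) : scaled ψ g hg 1 = central g :=
  DimDrop.ext fun s => by rw [scaled_apply, map_one, central_apply]

theorem normTrace_scaled [Nonempty d] [NeZero p] [NeZero q] (hg : IsCompatible ψ g)
    (A : Matrix d d ℂ) : normTrace (scaled ψ g hg A) = (A.trace / Fintype.card d) • g := by
  ext s
  have hpq : (p : ℂ) * q ≠ 0 := mul_ne_zero (NeZero.ne _) (NeZero.ne _)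
  rw [normTrace_apply, scaled_apply, Matrix.trace_smul,
    show (ψ A).trace = _ from trace_algHom_apply ψ.toAlgHom A, Fintype.card_prod,
    Fintype.card_fin, Fintype.card_fin, Nat.cast_mul, ContinuousMap.smul_apply, smul_eq_mul,
    smul_eq_mul, ← mul_assoc, mul_div_cancel_right₀ _ hpq, mul_comm]

variable {L : DimDrop p q →ₗ[ℂ] ℂ}

theorem apply_scaled_of_mul_comm [Nonempty d] (hL : ∀ f g, L (f * g) = L (g * f))
    (hg : IsCompatible ψ g) (A : Matrix d d ℂ) :
    L (scaled ψ g hg A) = A.trace / Fintype.card d * L (central g) := by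
  have hu : IsCompatible ψ (sqrtNorm g) := hg.of_eq_zero_imp fun s => sqrtNorm_eq_zero_iff.2
  have hw : IsCompatible ψ (divSqrtNorm g) := hg.of_eq_zero_imp fun s h0 => by
    rw [divSqrtNorm_apply, h0, smul_zero]
  have scaled_mul (A B : Matrix d d ℂ) :
      scaled ψ (sqrtNorm g) hu A * scaled ψ (divSqrtNorm g) hw B = scaled ψ g hg (A * B) ∧
      scaled ψ (divSqrtNorm g) hw A * scaled ψ (sqrtNorm g) hu B = scaled ψ g hg (A * B) := by
    have h : sqrtNorm g * divSqrtNorm g = g := ContinuousMap.ext (sqrtNorm_smul_divSqrtNorm g)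
    simp only [scaled_mul_scaled, mul_comm (divSqrtNorm g), h, and_self]
  rw [← scaled_one hg]
  refine eq_trace_div_card_mul (L := L ∘ₗ scaled ψ g hg) (fun A B => ?_) A
  rw [LinearMap.comp_apply, ← (scaled_mul A B).1, hL, (scaled_mul B A).2]; rfl

theorem apply_scaled_eq_apply_central_normTrace [Nonempty d] [NeZero p] [NeZero q]
    (hL : ∀ f g, L (f * g) = L (g * f)) (hg : IsCompatible ψ g) (A : Matrix d d ℂ) :
    L (scaled ψ g hg A) = L (central (normTrace (scaled ψ g hg A))) := by
  rw [apply_scaled_of_mul_comm hL, normTrace_scaled, map_smul, map_smul, smul_eq_mul]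

/-- The function `s ↦ f s i j`. -/
def matrixEntry (f : DimDrop p q) (i j : Fin p × Fin q) : C(I, ℂ) :=
  ⟨fun s => f.1 s i j, f.1.continuous.matrix_elem i j⟩

theorem isCompatible_id_matrixEntry {f : DimDrop p q} (h0 : f.1 0 = 0) (h1 : f.1 1 = 0)
    (i j : Fin p × Fin q) :
    IsCompatible (.id ℂ (Matrix (Fin p × Fin q) (Fin p × Fin q) ℂ)) (matrixEntry f i j) :=
  isCompatible_id (congrFun₂ h0 i j) (congrFun₂ h1 i j)

theorem eq_sum_scaled {f : DimDrop p q} (h0 : f.1 0 = 0) (h1 : f.1 1 = 0) :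
    f = ∑ i, ∑ j, scaled (.id ℂ _) (matrixEntry f i j) (isCompatible_id_matrixEntry h0 h1 i j)
      (Matrix.single i j 1) := DimDrop.ext fun s => by
  rw [← evalHom_apply s (∑ i, _), map_sum]
  simp only [map_sum, evalHom_apply, scaled_apply]
  conv_lhs => rw [Matrix.matrix_eq_sum_single (f.1 s)]
  simp [matrixEntry, Matrix.smul_single]

theorem exists_eq_scaled_add_scaled_add [NeZero p] [NeZero q] (f : DimDrop p q) :
    ∃ f₀ : DimDrop p q, f₀.1 0 = 0 ∧ f₀.1 1 = 0 ∧
      f = scaled ampLeft (1 - coordinate) (isCompatible_ampLeft (by simp [coordinate_one]))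
          (leftEnd f) +
        scaled ampRight coordinate (isCompatible_ampRight coordinate_zero) (rightEnd f) + f₀ := by
  refine ⟨f - (_ + _), ?_, ?_, (add_sub_cancel _ f).symm⟩
  · simp [scaled_apply, coordinate_zero, ampLeft_leftEnd]
  · simp [scaled_apply, coordinate_one, ampRight_rightEnd]

theorem apply_eq_apply_central_normTrace [NeZero p] [NeZero q]
    (hL : ∀ f g, L (f * g) = L (g * f)) (f : DimDrop p q) :
    L f = L (central (normTrace f)) := by
  obtain ⟨f₀, h0, h1, hf⟩ := exists_eq_scaled_add_scaled_add f
  have eq_of_vanishing : L f₀ = L (central (normTrace f₀)) := by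
    rw [eq_sum_scaled h0 h1]
    simp only [map_sum]
    exact Finset.sum_congr rfl fun i _ => Finset.sum_congr rfl fun j _ =>
      apply_scaled_eq_apply_central_normTrace hL _ _
  rw [hf]
  simp only [map_add]
  rw [← eq_of_vanishing, ← apply_scaled_eq_apply_central_normTrace hL,
    ← apply_scaled_eq_apply_central_normTrace hL]

end TracialFunctionals

section TracialStates

open scoped ComplexOrder

variable {A : Type*} [CStarAlgebra A] {τ : A →ₗ[ℂ] ℂ}

namespace IsTracialState

theorem map_star_mul_self_nonneg (hτ : IsTracialState τ) (x : A) : 0 ≤ τ (star x * x) :=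
  Complex.nonneg_iff.2 ⟨(hτ.nonneg x).1, (hτ.nonneg x).2.symm⟩

/-- A tracial state as a positive linear functional. -/
def positiveFunctional [PartialOrder A] [StarOrderedRing A] (hτ : IsTracialState τ) : A →ₚ[ℂ] ℂ :=
  .mk₀ τ fun x hx => by
    obtain ⟨c, rfl⟩ := CStarAlgebra.nonneg_iff_eq_star_mul_self.1 hx
    exact hτ.map_star_mul_self_nonneg c

protected theorem continuous (hτ : IsTracialState τ) : Continuous τ := by
  let _ := CStarAlgebra.spectralOrder A
  have := CStarAlgebra.spectralOrderedRing A
  exact map_continuous hτ.positiveFunctional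

theorem norm_toPreGNS_eq_zero_iff [PartialOrder A] [StarOrderedRing A] (hτ : IsTracialState τ)
    {x : A} : ‖hτ.positiveFunctional.toPreGNS x‖ = 0 ↔ τ (star x * x) = 0 := by
  rw [← sq_eq_zero_iff, ← Complex.ofReal_eq_zero, Complex.ofReal_pow,
    PositiveLinearMap.preGNS_norm_sq]
  rfl

theorem map_star_mul_self_mul_left (hτ : IsTracialState τ) (a : A) {x : A}
    (hx : τ (star x * x) = 0) : τ (star (a * x) * (a * x)) = 0 := by
  let _ := CStarAlgebra.spectralOrder A
  have := CStarAlgebra.spectralOrderedRing A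
  rw [← hτ.norm_toPreGNS_eq_zero_iff] at hx ⊢
  have h := (hτ.positiveFunctional.leftMulMapPreGNS a).le_opNorm (hτ.positiveFunctional.toPreGNS x)
  rw [hx, mul_zero] at h
  exact le_antisymm h (norm_nonneg _)

theorem map_star_mul_self_add (hτ : IsTracialState τ) {x y : A} (hx : τ (star x * x) = 0)
    (hy : τ (star y * y) = 0) : τ (star (x + y) * (x + y)) = 0 := by
  let _ := CStarAlgebra.spectralOrder A
  have := CStarAlgebra.spectralOrderedRing A
  rw [← hτ.norm_toPreGNS_eq_zero_iff] at hx hy ⊢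
  refine le_antisymm ?_ (norm_nonneg _)
  rw [map_add]
  exact (norm_add_le _ _).trans_eq (by rw [hx, hy, add_zero])

theorem map_star_mul_self_mul_right (hτ : IsTracialState τ) (a : A) {x : A}
    (hx : τ (star x * x) = 0) : τ (star (x * a) * (x * a)) = 0 := by
  have hx' : τ (star (star x) * star x) = 0 := by rwa [star_star, hτ.trace]
  rw [hτ.trace]
  simpa only [star_mul, star_star] using hτ.map_star_mul_self_mul_left (star a) hx'

/-- The ideal of the elements `x` with `τ (star x * x) = 0`, the kernel of the GNS representation
of the tracial state `τ`. -/
def nullIdeal (hτ : IsTracialState τ) : TwoSidedIdeal A :=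
  .mk' {x | τ (star x * x) = 0} (by simp) hτ.map_star_mul_self_add
    (fun {x} hx => by simpa using hx) (hτ.map_star_mul_self_mul_left _)
    (hτ.map_star_mul_self_mul_right _)

theorem mem_nullIdeal (hτ : IsTracialState τ) {x : A} :
    x ∈ hτ.nullIdeal ↔ τ (star x * x) = 0 := by
  rw [nullIdeal, TwoSidedIdeal.mem_mk']
  rfl

theorem isClosed_nullIdeal (hτ : IsTracialState τ) : IsClosed (hτ.nullIdeal : Set A) := by
  have h : (hτ.nullIdeal : Set A) = {x | τ (star x * x) = 0} := Set.ext fun _ => hτ.mem_nullIdeal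
  have hτc := hτ.continuous
  rw [h]
  exact isClosed_eq (by fun_prop) continuous_const

theorem eq_zero_of_isSimple (hτ : IsTracialState τ) (hA : IsSimpleCStarAlgebra A)
    {x : A} (hx : τ (star x * x) = 0) : x = 0 := by
  rcases hA.2 hτ.nullIdeal hτ.isClosed_nullIdeal with h | h
  · rwa [← hτ.mem_nullIdeal, h, TwoSidedIdeal.mem_bot] at hx
  · have h1 : (1 : A) ∈ hτ.nullIdeal := h ▸ TwoSidedIdeal.mem_top A
    rw [hτ.mem_nullIdeal, star_one, mul_one, hτ.map_one] at h1
    exact absurd h1 one_ne_zero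

end IsTracialState

end TracialStates

section LimitTraces

open scoped ComplexOrder

variable {A : ℕ → Type*} [∀ n, CStarAlgebra (A n)]

theorem isTracialState_of_forall_toLimit {S : CStarSystem A} {τ : S.Limit →L[ℂ] ℂ}
    (h1 : τ 1 = 1) (hpos : ∀ x : S.PreLimit, 0 ≤ τ (star x * x).toLimit)
    (hcomm : ∀ x y : S.PreLimit, τ (x * y).toLimit = τ (y * x).toLimit) :
    IsTracialState (τ : S.Limit →ₗ[ℂ] ℂ) := by
  have hpos' (x : S.Limit) : 0 ≤ τ (star x * x) :=
    Limit.ind (P := fun x => 0 ≤ τ (star x * x)) x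
      (isClosed_le continuous_const (by fun_prop)) fun a => by
        simpa only [Limit.toLimit_mul, Limit.toLimit_star] using hpos a
  refine ⟨h1, fun x => ?_, fun x y => ?_⟩
  · obtain ⟨hre, him⟩ := Complex.nonneg_iff.1 (hpos' x)
    exact ⟨hre, him.symm⟩
  · refine Limit.ind (P := fun x => τ (x * y) = τ (y * x)) x
      (isClosed_eq (by fun_prop) (by fun_prop)) fun a => ?_
    refine Limit.ind (P := fun y => τ (a.toLimit * y) = τ (y * a.toLimit)) y
      (isClosed_eq (by fun_prop) (by fun_prop)) fun b => ?_
    simpa only [Limit.toLimit_mul] using hcomm a b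

theorem exists_extension_toLimit {S : CStarSystem A} (L : S.PreLimit →ₗ[ℂ] ℂ)
    (hL : ∀ x, ‖L x‖ ≤ ‖x‖) : ∃ τ : S.Limit →L[ℂ] ℂ, ∀ x, τ x.toLimit = L x := by
  let e : S.PreLimit →ₗ[ℂ] S.Limit :=
    { toFun := PreLimit.toLimit
      map_add' := Limit.toLimit_add
      map_smul' := Limit.toLimit_smul }
  have hdense : DenseRange e := UniformSpace.Completion.denseRange_coe
  have hbound : ∃ C, ∀ x, ‖L x‖ ≤ C * ‖e x‖ :=
    ⟨1, fun x => (hL x).trans_eq (by rw [one_mul]; exact (Limit.norm_toLimit x).symm)⟩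
  exact ⟨L.extendOfNorm e, LinearMap.extendOfNorm_eq hdense hbound⟩

variable {p q : ℕ → ℕ} [∀ n, NeZero (p n)] [∀ n, NeZero (q n)]
  {S : CStarSystem fun n => DimDrop (p n) (q n)} {ω : Ultrafilter ℕ}

theorem exists_tendsto_normTrace (s : ℕ → I) (hω : ω ≤ (atTop : Filter ℕ)) (x : S.PreLimit) :
    ∃ z : ℂ, ‖z‖ ≤ ‖x‖ ∧ Tendsto (fun n => normTrace (x.entry n) (s n)) ω (𝓝 z) := by
  have hx := (PreLimit.tendsto_norm x).mono_left hω
  have hbdd : ∀ᶠ n in (ω : Filter ℕ), normTrace (x.entry n) (s n) ∈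
      Metric.closedBall (0 : ℂ) (‖x‖ + 1) := by
    filter_upwards [hx.eventually_le_const (lt_add_one _)] with n hn
    exact mem_closedBall_zero_iff.2 ((norm_normTrace_le _ _).trans hn)
  obtain ⟨z, -, hz⟩ := (isCompact_closedBall (0 : ℂ) (‖x‖ + 1)).ultrafilter_le_nhds
    (ω.map fun n => normTrace (x.entry n) (s n)) (le_principal_iff.2 hbdd)
  exact ⟨z, le_of_tendsto_of_tendsto' (Tendsto.norm hz) hx fun n => norm_normTrace_le _ _, hz⟩

theorem exists_tracialState_tendsto_normTrace (s : ℕ → I)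
    (hω : ω ≤ (atTop : Filter ℕ)) :
    ∃ τ : S.Limit →ₗ[ℂ] ℂ, IsTracialState τ ∧ ∀ x : S.PreLimit,
      Tendsto (fun n => normTrace (x.entry n) (s n)) ω (𝓝 (τ x.toLimit)) := by
  choose L hnorm hL using exists_tendsto_normTrace (S := S) s hω
  have hadd (x y : S.PreLimit) : L (x + y) = L x + L y :=
    tendsto_nhds_unique (hL (x + y)) <| ((hL x).add (hL y)).congr fun n =>
      (DFunLike.congr_fun (map_add normTrace (x.entry n) (y.entry n)) (s n)).symm
  have hsmul (r : ℂ) (x : S.PreLimit) : L (r • x) = r • L x :=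
    tendsto_nhds_unique (hL (r • x)) <| ((hL x).const_smul r).congr fun n =>
      (DFunLike.congr_fun (map_smul normTrace r (x.entry n)) (s n)).symm
  obtain ⟨τ, hτ⟩ := exists_extension_toLimit
    { toFun := L, map_add' := hadd, map_smul' := hsmul } hnorm
  replace hτ (x : S.PreLimit) : τ x.toLimit = L x := hτ x
  refine ⟨τ, isTracialState_of_forall_toLimit ?_ (fun x => ?_) fun x y => ?_, fun x => ?_⟩
  · refine (hτ 1).trans (tendsto_nhds_unique (hL 1) (tendsto_const_nhds.congr fun n => ?_))
    exact (DFunLike.congr_fun normTrace_one (s n)).symm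
  · rw [hτ]
    exact ge_of_tendsto' (hL (star x * x)) fun n => normTrace_star_mul_self_nonneg (x.entry n) (s n)
  · rw [hτ, hτ]
    exact tendsto_nhds_unique (hL (x * y)) <| (hL (y * x)).congr fun n =>
      DFunLike.congr_fun (normTrace_mul_comm (y.entry n) (x.entry n)) (s n)
  · exact (hτ x).symm ▸ hL x

theorem exists_isTracialState (S : CStarSystem fun n => DimDrop (p n) (q n)) :
    ∃ τ : S.Limit →ₗ[ℂ] ℂ, IsTracialState τ := by
  obtain ⟨τ, hτ, -⟩ := exists_tracialState_tendsto_normTrace (S := S) (fun _ => 0)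
    (Ultrafilter.of_le atTop)
  exact ⟨τ, hτ⟩

end LimitTraces

/-! ### Homomorphisms of small variation -/

section SmallVariation

theorem exists_isEigenvaluePattern_of_variation_lt {p q p' q' : ℕ} [NeZero p] [NeZero q]
    {ι : DimDrop p q →⋆ₐ[ℂ] DimDrop p' q'} {δ : ℝ≥0∞} (h : variation ι < δ) :
    ∃ (a b k : ℕ) (t : Fin k → C(I, I)), IsEigenvaluePattern ι a b t ∧
      ∀ i s s', edist (t i s) (t i s') < δ := by
  simp only [variation, iInf_lt_iff] at h
  obtain ⟨k, t, ⟨⟨a, b, ht⟩, -⟩, hlt⟩ := h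
  refine ⟨a, b, k, t, ht, fun i s s' => lt_of_le_of_lt ?_ hlt⟩
  exact (Metric.edist_le_ediam_of_mem (Set.mem_range_self s) (Set.mem_range_self s')).trans
    (le_iSup (fun i => Metric.ediam (Set.range (t i))) i)

theorem norm_apply_le_of_norm_normTrace_sub_le {B : Type*} [CStarAlgebra B] {p q : ℕ} [NeZero p]
    [NeZero q] (D : B →L[ℂ] ℂ) (hD1 : D 1 = 0) (hD : ∀ x y, D (x * y) = D (y * x))
    (Φ : DimDrop p q →⋆ₐ[ℂ] B) {f : DimDrop p q} {c : ℂ} {r : ℝ}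
    (hf : ∀ s, ‖normTrace f s - c‖ ≤ r) : ‖D (Φ f)‖ ≤ ‖D‖ * r := by
  let Ψ : C(I, ℂ) →⋆ₐ[ℂ] B := Φ.comp central
  have htrace : D (Φ f) = D (Ψ (normTrace f)) := by
    let L : DimDrop p q →ₗ[ℂ] ℂ := (D : B →ₗ[ℂ] ℂ) ∘ₗ Φ.toAlgHom.toLinearMap
    refine apply_eq_apply_central_normTrace (L := L) (fun f g => ?_) f
    change D (Φ (f * g)) = D (Φ (g * f))
    rw [map_mul Φ f g, map_mul Φ g f, hD]
  have hconst : D (Ψ (normTrace f - algebraMap ℂ _ c)) = D (Ψ (normTrace f)) := by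
    rw [map_sub, map_sub, AlgHomClass.commutes, Algebra.algebraMap_eq_smul_one, map_smul, hD1,
      smul_zero, sub_zero]
  rw [htrace, ← hconst]
  refine (D.le_opNorm _).trans (mul_le_mul_of_nonneg_left ?_ (norm_nonneg _))
  refine (NonUnitalStarAlgHom.norm_apply_le Ψ _).trans ?_
  exact (ContinuousMap.norm_le_of_nonempty _).2 hf

variable {p q : ℕ → ℕ} [∀ n, NeZero (p n)] [∀ n, NeZero (q n)]
  {S : CStarSystem fun n => DimDrop (p n) (q n)}

theorem eventually_forall_exists_unitary_norm_sub_le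
    (hV : ∀ m : ℕ, Tendsto (fun n : Set.Ici m => variation (S.map n.2)) atTop (𝓝 0))
    {m : ℕ} (f : DimDrop (p m) (q m)) {r : ℝ} (hr : 0 < r) :
    ∀ᶠ n in atTop, ∀ h : m ≤ n, ∀ s s' : I,
      ∃ u ∈ Matrix.unitaryGroup (Fin (p n) × Fin (q n)) ℂ,
        ‖(S.map h f).1 s - u * (S.map h f).1 s' * star u‖ ≤ r := by
  have huc : UniformContinuous f.1 := CompactSpace.uniformContinuous_of_continuous f.1.continuous
  obtain ⟨δ, hδ, hfδ⟩ := EMetric.uniformContinuous_iff.1 huc (ENNReal.ofReal r)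
    (ENNReal.ofReal_pos.2 hr)
  obtain ⟨N, hN⟩ := eventually_atTop.1 ((hV m).eventually_lt_const hδ)
  filter_upwards [eventually_ge_atTop N.1] with n hn h s s'
  obtain ⟨a, b, k, t, ht, htδ⟩ := exists_isEigenvaluePattern_of_variation_lt (hN ⟨n, h⟩ hn)
  refine ht.exists_unitary_norm_sub_le f s s' hr.le fun i => ?_
  have hi := hfδ (htδ i s s')
  rw [edist_dist, ENNReal.ofReal_lt_ofReal_iff hr, dist_eq_norm] at hi
  exact hi.le

theorem isMonotracial_of_tendsto_variation
    (hV : ∀ m : ℕ, Tendsto (fun n : Set.Ici m => variation (S.map n.2)) atTop (𝓝 0)) :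
    IsMonotracial S.Limit := by
  obtain ⟨τ, hτ⟩ := exists_isTracialState S
  refine ⟨τ, hτ, fun τ' hτ' => LinearMap.ext fun x => sub_eq_zero.1 ?_⟩
  let D : S.Limit →L[ℂ] ℂ := ⟨τ', hτ'.continuous⟩ - ⟨τ, hτ.continuous⟩
  have hD1 : D 1 = 0 := sub_eq_zero.2 (hτ'.map_one.trans hτ.map_one.symm)
  have hD (x y : S.Limit) : D (x * y) = D (y * x) :=
    congrArg₂ (· - ·) (hτ'.trace x y) (hτ.trace x y)
  refine CStarSystem.Limit.ind_incl (P := fun x => D x = 0) x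
    (isClosed_eq D.continuous continuous_const) fun m f => norm_le_zero_iff.1 ?_
  refine le_of_forall_pos_le_add fun ε hε => ?_
  obtain ⟨r, hr, hrε⟩ := exists_pos_mul_lt hε ‖D‖
  obtain ⟨n, hn, hmn⟩ := ((eventually_forall_exists_unitary_norm_sub_le hV f hr).and
    (eventually_ge_atTop m)).exists
  rw [← CStarSystem.incl_map hmn, zero_add]
  refine (norm_apply_le_of_norm_normTrace_sub_le D hD1 hD (S.incl n)
    (c := normTrace (S.map hmn f) 0) fun s => ?_).trans hrε.le
  obtain ⟨u, hu, hur⟩ := hn hmn s 0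
  exact (norm_normTrace_sub_normTrace_le hu).trans hur

end SmallVariation

section PositiveElements

variable {B : Type*} [CStarAlgebra B] [PartialOrder B] [StarOrderedRing B]

theorem posPart_conjugate_algebraMap_le {b : B} (hb : IsSelfAdjoint b) (r : ℝ) :
    (b - algebraMap ℝ B r)⁺ * algebraMap ℝ B r * (b - algebraMap ℝ B r)⁺ ≤
      (b - algebraMap ℝ B r)⁺ * b * (b - algebraMap ℝ B r)⁺ := by
  have hd : IsSelfAdjoint (b - algebraMap ℝ B r) := hb.sub (.algebraMap B (.all r))
  obtain ⟨d, hbd⟩ : ∃ d, d = b - algebraMap ℝ B r := ⟨_, rfl⟩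
  rw [← hbd] at hd ⊢
  have hpos : 0 ≤ d⁺ := CFC.posPart_nonneg d
  have hmul : d⁺ * d = d⁺ * d⁺ := by
    nth_rewrite 2 [← CFC.posPart_sub_negPart d hd]
    rw [mul_sub, CFC.posPart_mul_negPart, sub_zero]
  rw [← sub_nonneg, ← sub_mul, ← mul_sub, ← hbd, hmul]
  exact conjugate_nonneg_of_nonneg hpos hpos

theorem norm_map_star_mul_self_le_of_map_posPart_eq_zero {A : Type*} [CStarAlgebra A]
    [PartialOrder A] [StarOrderedRing A] (φ : B →⋆ₐ[ℂ] A) {g : B} {r : ℝ} (hr : 0 ≤ r)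
    (h : φ (star g * g - algebraMap ℝ B r)⁺ = 0) : ‖star (φ g) * φ g‖ ≤ r := by
  have hle : star g * g - algebraMap ℝ B r ≤ (star g * g - algebraMap ℝ B r)⁺ :=
    CFC.le_posPart ((IsSelfAdjoint.star_mul_self g).sub (.algebraMap B (.all r)))
  have hmap := OrderHomClass.mono φ hle
  rw [h, map_sub, map_mul, map_star, sub_nonpos, IsScalarTower.algebraMap_apply ℝ ℂ B,
    AlgHomClass.commutes, ← IsScalarTower.algebraMap_apply] at hmap
  exact (CStarAlgebra.norm_le_iff_le_algebraMap _ hr (star_mul_self_nonneg _)).2 hmap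

theorem conjugate_algebraMap_le_of_norm_sub_le {a b y : B} {δ ε : ℝ} (ha : IsSelfAdjoint a)
    (hb : IsSelfAdjoint b) (hy : IsSelfAdjoint y) (hab : ‖b - a‖ ≤ ε)
    (h : y * algebraMap ℝ B (δ + ε) * y ≤ y * b * y) : y * algebraMap ℝ B δ * y ≤ y * a * y := by
  have hba : b - a ≤ algebraMap ℝ B ε :=
    (hb.sub ha).le_algebraMap_norm_self.trans (algebraMap_mono B hab)
  have hconj := h.trans (hy.conjugate_le_conjugate (sub_le_iff_le_add'.1 hba))
  simpa only [map_add, mul_add, add_mul, add_le_add_iff_right] using hconj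

theorem eq_top_of_conjugate_algebraMap_le {K : TwoSidedIdeal B} {a y : B} (haK : a ∈ K)
    (hy : IsSelfAdjoint y) {δ : ℝ} (hδ : 0 < δ) (h : y * algebraMap ℝ B δ * y ≤ y * a * y)
    {J : Type*} [Fintype J] (z : J → B) (hz : IsUnit (∑ j, star (y * z j) * (y * z j))) :
    K = ⊤ := by
  have hterm (j : J) : δ • (star (y * z j) * (y * z j)) ≤ star (z j) * (y * a * y) * z j := by
    refine le_of_eq_of_le ?_ (star_left_conjugate_le_conjugate h (z j))
    simp only [Algebra.algebraMap_eq_smul_one, star_mul, hy.star_eq, mul_smul_comm, mul_one,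
      smul_mul_assoc, mul_assoc]
  have hle : δ • ∑ j, star (y * z j) * (y * z j) ≤ ∑ j, star (z j) * (y * a * y) * z j := by
    rw [Finset.smul_sum]
    exact Finset.sum_le_sum fun j _ => hterm j
  have hpos : IsStrictlyPositive (δ • ∑ j, star (y * z j) * (y * z j)) := by
    refine IsUnit.isStrictlyPositive ?_ ?_
    · exact (isUnit_smul_iff (Units.mk0 δ hδ.ne') _).2 hz
    · exact smul_nonneg hδ.le (Finset.sum_nonneg fun j _ => star_mul_self_nonneg _)
  obtain ⟨u, hu⟩ := CStarAlgebra.isUnit_of_le _ hle hpos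
  have huK : (u : B) ∈ K := hu ▸ sum_mem fun j _ =>
    K.mul_mem_right _ _ (K.mul_mem_left _ _ (K.mul_mem_right _ _ (K.mul_mem_left _ _ haK)))
  refine K.eq_top ?_
  simpa only [Units.inv_mul] using K.mul_mem_left (↑u⁻¹) _ huK

end PositiveElements

section Fullness

theorem sum_star_mul_single {n : Type*} [Fintype n] [DecidableEq n] (M : Matrix n n ℂ) :
    ∑ x : n × n, star (M * Matrix.single x.1 x.2 1) * (M * Matrix.single x.1 x.2 1) =
      (star M * M).trace • (1 : Matrix n n ℂ) := by
  have hterm (i k : n) : star (M * Matrix.single i k (1 : ℂ)) * (M * Matrix.single i k 1) =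
      (star M * M) i i • Matrix.single k k 1 := by
    rw [star_mul, Matrix.star_eq_conjTranspose (Matrix.single i k (1 : ℂ)),
      Matrix.conjTranspose_single, mul_assoc, ← mul_assoc (star M), ← mul_assoc,
      Matrix.single_mul_mul_single]
    simp
  rw [Fintype.sum_prod_type, Finset.sum_comm]
  simp only [hterm, ← Finset.sum_smul, ← Finset.smul_sum, Matrix.sum_single_one]
  rfl

open scoped ComplexOrder

variable {p q : ℕ}

theorem sum_star_mul_self_apply {J : Type*} [Fintype J] (z : J → DimDrop p q) (s : I) :
    (∑ j, star (z j) * z j).1 s = ∑ j, star ((z j).1 s) * (z j).1 s :=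
  map_sum (evalHom s : DimDrop p q →⋆ₐ[ℂ] _) _ _

theorem posSemidef_sum_star_mul_self_apply {J : Type*} [Fintype J] (z : J → DimDrop p q) (s : I) :
    ((∑ j, star (z j) * z j).1 s).PosSemidef := by
  rw [sum_star_mul_self_apply]
  exact Matrix.posSemidef_sum _ fun j _ => Matrix.posSemidef_conjTranspose_mul_self _

theorem posDef_sum_star_mul_scaled_apply {d : Type*} [Fintype d] [DecidableEq d]
    {ψ : Matrix d d ℂ →⋆ₐ[ℂ] Matrix (Fin p × Fin q) (Fin p × Fin q) ℂ} {g : C(I, ℂ)}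
    (hg : IsCompatible ψ g) {y : DimDrop p q} {s : I} (hgs : g s ≠ 0) (hy : y.1 s ≠ 0)
    {M : Matrix d d ℂ} (hM : ψ M = y.1 s) :
    ((∑ x : d × d, star (y * scaled ψ g hg (Matrix.single x.1 x.2 1)) *
      (y * scaled ψ g hg (Matrix.single x.1 x.2 1))).1 s).PosDef := by
  have hfactor (E : Matrix d d ℂ) : (y * scaled ψ g hg E).1 s = ψ ((g s • M) * E) := by
    rw [DimDrop.mul_apply, scaled_apply, ← hM, mul_smul_comm, ← map_mul, ← map_smul,
      smul_mul_assoc]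
  have hne : g s • M ≠ 0 := smul_ne_zero hgs fun h0 => hy (by rw [← hM, h0, map_zero])
  have htrace : 0 < (star (g s • M) * (g s • M)).trace :=
    (Matrix.posSemidef_conjTranspose_mul_self _).trace_nonneg.lt_of_ne' fun h0 =>
      hne (Matrix.trace_conjTranspose_mul_self_eq_zero_iff.1 h0)
  simp only [sum_star_mul_self_apply, hfactor, ← map_star, ← map_mul, ← map_sum]
  rw [sum_star_mul_single, map_smul, map_one]
  exact Matrix.PosDef.one.smul htrace

variable [NeZero p] [NeZero q]

theorem exists_isUnit_sum_star_mul_self {y : DimDrop p q} (hy : ∀ s, y.1 s ≠ 0) :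
    ∃ (J : Type) (_ : Fintype J) (z : J → DimDrop p q),
      IsUnit (∑ j, star (y * z j) * (y * z j)) := by
  let χ : C(I, ℂ) := coordinate
  have hχ0 : χ 0 = 0 := coordinate_zero
  have hχ1 : (1 - χ) 1 = 0 := sub_eq_zero.2 coordinate_one.symm
  have hmid := isCompatible_id (p := p) (q := q) (g := χ * (1 - χ))
    (mul_eq_zero_of_left hχ0 _) (mul_eq_zero_of_right _ hχ1)
  have hleft := isCompatible_ampLeft (p := p) (q := q) hχ1
  have hright := isCompatible_ampRight (p := p) (q := q) hχ0
  refine ⟨((Fin p × Fin q) × (Fin p × Fin q)) ⊕ (Fin p × Fin p) ⊕ (Fin q × Fin q), inferInstance,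
    Sum.elim (fun x => scaled _ _ hmid (Matrix.single x.1 x.2 1))
      (Sum.elim (fun x => scaled _ _ hleft (Matrix.single x.1 x.2 1))
        fun x => scaled _ _ hright (Matrix.single x.1 x.2 1)), ?_⟩
  rw [← StarSubalgebra.coe_isUnit, ContinuousMap.isUnit_iff_forall_isUnit]
  intro s
  refine Matrix.PosDef.isUnit ?_
  rw [Fintype.sum_sum_type, Fintype.sum_sum_type]
  simp only [Sum.elim_inl, Sum.elim_inr]
  have hpsd {J : Type} [Fintype J] (z : J → DimDrop p q) :=
    posSemidef_sum_star_mul_self_apply z s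
  by_cases h0 : s = 0
  · subst h0
    refine .posSemidef_add (hpsd _) (.add_posSemidef ?_ (hpsd _))
    exact posDef_sum_star_mul_scaled_apply hleft (by simp [hχ0]) (hy 0) (ampLeft_leftEnd y)
  by_cases h1 : s = 1
  · subst h1
    refine .posSemidef_add (hpsd _) (.posSemidef_add (hpsd _) ?_)
    exact posDef_sum_star_mul_scaled_apply hright (by simp [χ, coordinate_one]) (hy 1)
      (ampRight_rightEnd y)
  · refine .add_posSemidef ?_ ((hpsd _).add (hpsd _))
    refine posDef_sum_star_mul_scaled_apply hmid (mul_ne_zero ?_ (sub_ne_zero.2 ?_)) (hy s) rfl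
    · exact hχ0 ▸ coordinate_injective.ne h0
    · exact coordinate_one ▸ (coordinate_injective.ne h1).symm

end Fullness

section Simplicity

theorem ideal_eq_top_of_lt_norm_map {C B X : Type*} [CStarAlgebra C] [CStarAlgebra B]
    {A : X → Type*} [∀ s, CStarAlgebra (A s)] (φ : ∀ s, C →⋆ₐ[ℂ] A s)
    (hfull : ∀ y : C, (∀ s, φ s y ≠ 0) →
      ∃ (J : Type) (_ : Fintype J) (z : J → C), IsUnit (∑ j, star (y * z j) * (y * z j)))
    (Φ : C →⋆ₐ[ℂ] B) {K : TwoSidedIdeal B} {a : B} (haK : a ∈ K) (ha : IsSelfAdjoint a)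
    {g : C} {δ ε : ℝ} (hδ : 0 < δ) (hg : ∀ s, δ + ε < ‖star (φ s g) * φ s g‖)
    (hag : ‖star (Φ g) * Φ g - a‖ ≤ ε) : K = ⊤ := by
  let _ := CStarAlgebra.spectralOrder B
  let _ := CStarAlgebra.spectralOrderedRing B
  let _ := CStarAlgebra.spectralOrder C
  let _ := CStarAlgebra.spectralOrderedRing C
  let _ (s : X) := CStarAlgebra.spectralOrder (A s)
  let _ (s : X) := CStarAlgebra.spectralOrderedRing (A s)
  have hε : 0 ≤ ε := (norm_nonneg _).trans hag
  let y : C := (star g * g - algebraMap ℝ C (δ + ε))⁺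
  have hy : IsSelfAdjoint y := (CFC.posPart_nonneg _).isSelfAdjoint
  have hy0 (s : X) : φ s y ≠ 0 := fun h => (hg s).not_ge <|
    norm_map_star_mul_self_le_of_map_posPart_eq_zero (φ s) (by positivity) h
  obtain ⟨J, _, z, hz⟩ := hfull y hy0
  have hΦ : Φ y * algebraMap ℝ B (δ + ε) * Φ y ≤ Φ y * (star (Φ g) * Φ g) * Φ y := by
    have h := OrderHomClass.mono Φ
      (posPart_conjugate_algebraMap_le (IsSelfAdjoint.star_mul_self g) (δ + ε))
    have hr : Φ (algebraMap ℝ C (δ + ε)) = algebraMap ℝ B (δ + ε) := by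
      rw [IsScalarTower.algebraMap_apply ℝ ℂ C, AlgHomClass.commutes,
        ← IsScalarTower.algebraMap_apply]
    simpa only [map_mul, map_star, hr] using h
  refine eq_top_of_conjugate_algebraMap_le haK (hy.map Φ) hδ
    (conjugate_algebraMap_le_of_norm_sub_le ha (.star_mul_self _) (hy.map Φ) hag hΦ)
    (fun j => Φ (z j)) ?_
  simpa only [map_sum, map_mul, map_star] using hz.map Φ

theorem ideal_eq_top_of_nearly_constant {p q : ℕ} [NeZero p] [NeZero q] {B : Type*}
    [CStarAlgebra B] (Φ : DimDrop p q →⋆ₐ[ℂ] B) {K : TwoSidedIdeal B} {x : B} (hxK : x ∈ K)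
    {c : ℝ} (hc : 0 < c) (hcx : ‖x‖ = 3 * c) {g : DimDrop p q}
    (hxg : ‖star (Φ g) * Φ g - star x * x‖ ≤ c * c)
    (hgs : ∀ s s' : I, ∃ u ∈ Matrix.unitaryGroup (Fin p × Fin q) ℂ,
      ‖g.1 s - u * g.1 s' * star u‖ ≤ c) : K = ⊤ := by
  have hΦg : 8 * (c * c) ≤ ‖Φ g‖ * ‖Φ g‖ := by
    have h := norm_le_norm_add_norm_sub (star (Φ g) * Φ g) (star x * x)
    rw [CStarRing.norm_star_mul_self, CStarRing.norm_star_mul_self, hcx] at h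
    linarith
  obtain ⟨s₀, hs₀⟩ : ∃ s, 5 / 2 * c < ‖g.1 s‖ := by
    by_contra! h
    have hΦ : ‖Φ g‖ ≤ 5 / 2 * c :=
      (NonUnitalStarAlgHom.norm_apply_le Φ g).trans (DimDrop.norm_le (by positivity) h)
    nlinarith [norm_nonneg (Φ g)]
  have hg (s : I) : c * c + c * c < ‖star (g.1 s) * g.1 s‖ := by
    obtain ⟨u, hu, hus⟩ := hgs s₀ s
    have h := norm_le_norm_add_norm_sub' (g.1 s₀) (u * g.1 s * star u)
    rw [norm_unitary_mul_mul_star hu] at h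
    rw [CStarRing.norm_star_mul_self]
    nlinarith
  refine ideal_eq_top_of_lt_norm_map (C := DimDrop p q) evalHom ?_ Φ (K.mul_mem_left _ _ hxK)
    (.star_mul_self x) (mul_pos hc hc) hg hxg
  intro y hy
  exact exists_isUnit_sum_star_mul_self hy

theorem exists_norm_star_incl_mul_incl_sub_le {A : ℕ → Type*} [∀ n, CStarAlgebra (A n)]
    {S : CStarSystem A} (x : S.Limit) {ε : ℝ} (hε : 0 < ε) :
    ∃ (m : ℕ) (a : A m), ‖star (S.incl m a) * S.incl m a - star x * x‖ ≤ ε := by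
  by_contra! hfar
  have hself : ε ≤ ‖star x * x - star x * x‖ :=
    Limit.ind_incl (P := fun y => ε ≤ ‖star y * y - star x * x‖) x
      (isClosed_le continuous_const (by fun_prop)) fun m a => (hfar m a).le
  rw [sub_self, norm_zero] at hself
  exact hself.not_gt hε

variable {p q : ℕ → ℕ} [∀ n, NeZero (p n)] [∀ n, NeZero (q n)]
  {S : CStarSystem (fun n => DimDrop (p n) (q n))}

theorem nontrivial_limit (S : CStarSystem fun n => DimDrop (p n) (q n)) : Nontrivial S.Limit := by
  obtain ⟨τ, hτ⟩ := exists_isTracialState S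
  refine ⟨0, 1, fun h => zero_ne_one (α := ℂ) ?_⟩
  rw [← map_zero τ, h, hτ.map_one]

theorem isSimple_of_tendsto_variation
    (hV : ∀ m : ℕ, Tendsto (fun n : Set.Ici m => variation (S.map n.2)) atTop (𝓝 0)) :
    IsSimpleCStarAlgebra S.Limit := by
  refine ⟨nontrivial_limit S, fun K _ => or_iff_not_imp_left.2 fun hK => ?_⟩
  obtain ⟨x, hxK, hx⟩ : ∃ x ∈ K, x ≠ 0 := by
    by_contra! h
    exact hK (le_bot_iff.1 fun x hx => (TwoSidedIdeal.mem_bot _).2 (h x hx))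
  obtain ⟨c, hc, hcx⟩ : ∃ c > 0, ‖x‖ = 3 * c :=
    ⟨‖x‖ / 3, div_pos (norm_pos_iff.2 hx) three_pos, by ring⟩
  obtain ⟨m, f, hf⟩ := exists_norm_star_incl_mul_incl_sub_le x (mul_pos hc hc)
  obtain ⟨n, hn, hmn⟩ :=
    ((eventually_forall_exists_unitary_norm_sub_le hV f hc).and (eventually_ge_atTop m)).exists
  rw [← S.incl_map hmn] at hf
  exact ideal_eq_top_of_nearly_constant (S.incl n) hxK hc hcx hf (hn hmn)

end Simplicity

/-! ### Homomorphisms of large variation -/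

section LargeVariation

theorem exists_ultrafilter_eventually_of_frequently {α β : Type*} [Nonempty β] {l : Filter α}
    {P : α → β → Prop} (h : ∃ᶠ a in l, ∃ b, P a b) :
    ∃ ω : Ultrafilter α, ω ≤ l ∧ ∃ f : α → β, ∀ᶠ a in ω, P a (f a) := by
  obtain ⟨ω, hω⟩ := exists_ultrafilter_iff.2 (frequently_iff_neBot.1 h)
  exact ⟨ω, hω.trans inf_le_left, skolem.1 (hω.trans inf_le_right (mem_principal_self _))⟩

/-- The decreasing piecewise linear function that is `1` up to `c` and `0` from `d` on. -/
def ramp (c d : ℝ) : C(I, ℝ) := ⟨fun w => min 1 (max 0 ((d - w) / (d - c))), by fun_prop⟩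

theorem ramp_nonneg (c d : ℝ) (w : I) : 0 ≤ ramp c d w := le_min zero_le_one (le_max_left _ _)

theorem ramp_le_one (c d : ℝ) (w : I) : ramp c d w ≤ 1 := min_le_left _ _

theorem ramp_eq_one {c d : ℝ} (h : c < d) {w : I} (hw : (w : ℝ) ≤ c) : ramp c d w = 1 :=
  min_eq_left (le_max_of_le_right ((one_le_div (sub_pos.2 h)).2 (sub_le_sub_left hw d)))

theorem ramp_eq_zero {c d : ℝ} (h : c < d) {w : I} (hw : d ≤ w) : ramp c d w = 0 := by
  have hle : (d - w) / (d - c) ≤ 0 :=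
    div_nonpos_of_nonpos_of_nonneg (sub_nonpos.2 hw) (sub_pos.2 h).le
  exact (congrArg (min 1) (max_eq_left hle)).trans (min_eq_right zero_le_one)

theorem ramp_le_ramp {x z y : ℝ} (hxz : x < z) (hzy : z < y) (w : I) :
    ramp x z w ≤ ramp z y w := by
  rcases le_total (w : ℝ) z with hw | hw
  · exact (ramp_le_one x z w).trans_eq (ramp_eq_one hzy hw).symm
  · exact (ramp_eq_zero hxz hw).trans_le (ramp_nonneg z y w)

theorem exists_star_mul_complexify_eq_sub {g₁ g₂ : C(I, ℝ)} (h : ∀ w, g₁ w ≤ g₂ w) :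
    ∃ g : C(I, ℂ), star g * g = complexify g₂ - complexify g₁ := by
  let r : C(I, ℝ) := ⟨fun w => √(g₂ w - g₁ w), by fun_prop⟩
  refine ⟨complexify r, ContinuousMap.ext fun w => ?_⟩
  have hr : r w * r w = g₂ w - g₁ w := Real.mul_self_sqrt (sub_nonneg.2 (h w))
  rw [ContinuousMap.mul_apply, ContinuousMap.star_apply, ContinuousMap.sub_apply,
    complexify_apply, complexify_apply, complexify_apply, Complex.star_def, Complex.conj_ofReal]
  exact_mod_cast hr

section Crossing

variable {p q p' q' : ℕ} [NeZero p] [NeZero q] {ι : DimDrop p q →⋆ₐ[ℂ] DimDrop p' q'}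
  {x y : ℝ} {s s' : I}

/-- Some eigenvalue function in a normalized pattern of `ι` lies below `x` at `s` and above `y`
at `s'`. Homomorphisms of large variation have such crossings, with `x < y` fixed. -/
def EigenvalueCrosses (ι : DimDrop p q →⋆ₐ[ℂ] DimDrop p' q') (x y : ℝ) (s s' : I) : Prop :=
  ∃ (k : ℕ) (t : Fin k → C(I, I)) (i : Fin k), IsNormalizedPattern ι t ∧
    (t i s : ℝ) < x ∧ y < t i s'

theorem variation_le_of_forall_not_eigenvalueCrosses (hpq : p.Coprime q)
    {δ : ℝ} (hδ : 0 < δ)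
    (h : ∀ j ∈ Finset.range (⌊δ⁻¹⌋₊ + 1), ∀ s s',
      ¬ EigenvalueCrosses ι ((j + 1) * δ) ((j + 2) * δ) s s') :
    variation ι ≤ ENNReal.ofReal (2 * δ) := by
  obtain ⟨k, t, ht⟩ := exists_isNormalizedPattern hpq ι
  have hsub (i : Fin k) (s s' : I) : (t i s' : ℝ) - t i s ≤ 2 * δ := by
    by_contra! hlt
    have hle : ⌊(t i s : ℝ) / δ⌋₊ ≤ ⌊δ⁻¹⌋₊ := Nat.floor_le_floor <| by
      rw [← one_div]
      exact div_le_div_of_nonneg_right (t i s).2.2 hδ.le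
    have hfloor : ⌊(t i s : ℝ) / δ⌋₊ * δ ≤ t i s :=
      (le_div_iff₀ hδ).1 (Nat.floor_le (div_nonneg (t i s).2.1 hδ.le))
    refine h _ (Finset.mem_range_succ_iff.2 hle) s s' ⟨k, t, i, ht, ?_, by linarith⟩
    exact (div_lt_iff₀ hδ).1 (Nat.lt_floor_add_one _)
  refine (iInf_le_of_le k (iInf_le_of_le t (iInf_le _ ht))).trans (iSup_le fun i => ?_)
  refine Metric.ediam_le ?_
  rintro _ ⟨s, rfl⟩ _ ⟨s', rfl⟩
  rw [edist_dist, Subtype.dist_eq, Real.dist_eq]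
  exact ENNReal.ofReal_le_ofReal (abs_sub_le_iff.2 ⟨hsub i s' s, hsub i s s'⟩)

theorem EigenvalueCrosses.exists_forall_norm_apply_le
    (h : EigenvalueCrosses ι x y s s') {z : ℝ} (hxz : x ≤ z) (hzy : z ≤ y) :
    ∃ w : I, (w : ℝ) = z ∧ ∀ g : C(I, ℂ), ‖g w‖ ≤ ‖ι (central g)‖ := by
  obtain ⟨k, t, i, ⟨⟨a, b, ht⟩, -⟩, hlt, hgt⟩ := h
  obtain ⟨r, hr⟩ : z ∈ Set.range fun r => (t i r : ℝ) :=
    mem_range_of_exists_le_of_exists_ge (by fun_prop) ⟨s, hlt.le.trans hxz⟩ ⟨s', hzy.trans hgt.le⟩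
  exact ⟨t i r, hr, fun g => ht.norm_apply_le_norm g i r⟩

theorem IsEigenvaluePattern.re_normTrace_central_complexify {a b k : ℕ}
    {t : Fin k → C(I, I)} (h : IsEigenvaluePattern ι a b t) (g : C(I, ℝ)) (s : I) :
    (normTrace (ι (central (complexify g))) s).re =
      ((a * p) * g 0 + (p * q) * ∑ i, g (t i s) + (b * q) * g 1) / (p' * q') := by
  rw [normTrace_apply, h.trace_central, ← Complex.ofReal_re (_ / _)]
  push_cast
  rfl

-- With the `t j` in increasing order, at `s'` only those with `j < i` can lie in the support of
-- `ramp z y`, while at `s` all of these lie where `ramp x z` is `1`.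
theorem EigenvalueCrosses.re_normTrace_ramp_le
    (h : EigenvalueCrosses ι x y s s') {z : ℝ} (hxz : x < z) (hzy : z < y) :
    (normTrace (ι (central (complexify (ramp z y)))) s').re ≤
      (normTrace (ι (central (complexify (ramp x z)))) s).re := by
  obtain ⟨k, t, i, ⟨⟨a, b, ht⟩, hmono⟩, hs, hs'⟩ := h
  have hx0 : 0 ≤ x := (t i s).2.1.trans hs.le
  have hy1 : y ≤ 1 := hs'.le.trans (t i s').2.2
  have hupper : ∑ j, ramp z y (t j s') ≤ (Finset.Iio i).card := by
    rw [← Finset.sum_subset (Finset.subset_univ (Finset.Iio i)) fun j _ hj =>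
      ramp_eq_zero hzy (hs'.le.trans (hmono i j (not_lt.1 fun h => hj (Finset.mem_Iio.2 h)) s'))]
    exact (Finset.sum_le_card_nsmul _ _ _ fun j _ => ramp_le_one _ _ _).trans_eq (nsmul_one _)
  have hlower : ((Finset.Iio i).card : ℝ) ≤ ∑ j, ramp x z (t j s) := by
    calc ((Finset.Iio i).card : ℝ) = ∑ j ∈ Finset.Iio i, ramp x z (t j s) := by
          rw [Finset.sum_congr rfl fun j hj => ramp_eq_one hxz
            (le_trans (hmono j i (Finset.mem_Iio.1 hj).le s) hs.le), Finset.sum_const, nsmul_one]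
      _ ≤ ∑ j, ramp x z (t j s) :=
          Finset.sum_le_sum_of_subset_of_nonneg (Finset.subset_univ _) fun _ _ _ =>
            ramp_nonneg _ _ _
  rw [ht.re_normTrace_central_complexify, ht.re_normTrace_central_complexify,
    ramp_eq_one hzy (w := 0) (hx0.trans hxz.le), ramp_eq_one hxz (w := 0) hx0,
    ramp_eq_zero hzy (w := 1) hy1, ramp_eq_zero hxz (w := 1) (hzy.le.trans hy1)]
  have hsum := hupper.trans hlower
  gcongr

end Crossing

variable {p q : ℕ → ℕ} [∀ n, NeZero (p n)] [∀ n, NeZero (q n)]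
  {S : CStarSystem (fun n => DimDrop (p n) (q n))} {m : ℕ} {x z y : ℝ}

theorem IsMonotracial.re_apply_ramp_le (hmono : IsMonotracial S.Limit) {τ : S.Limit →ₗ[ℂ] ℂ}
    (hτ : IsTracialState τ) {ω : Ultrafilter ℕ} (hω : ω ≤ (atTop : Filter ℕ)) {s s' : ℕ → I}
    (hcross : ∀ᶠ n in ω, ∃ h : m ≤ n, EigenvalueCrosses (S.map h) x y (s n) (s' n))
    (hxz : x < z) (hzy : z < y) :
    (τ (S.incl m (central (complexify (ramp z y))))).re ≤
      (τ (S.incl m (central (complexify (ramp x z))))).re := by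
  obtain ⟨τ₁, hτ₁, hlim₁⟩ := exists_tracialState_tendsto_normTrace (S := S) s hω
  obtain ⟨τ₂, hτ₂, hlim₂⟩ := exists_tracialState_tendsto_normTrace (S := S) s' hω
  obtain rfl := hmono.unique hτ₁ hτ
  obtain rfl := hmono.unique hτ₂ hτ₁
  refine le_of_tendsto_of_tendsto
    ((Complex.continuous_re.tendsto _).comp (hlim₂ (S.preIncl m (central (complexify (ramp z y))))))
    ((Complex.continuous_re.tendsto _).comp (hlim₁ (S.preIncl m (central (complexify (ramp x z))))))
    (hcross.mono fun n hn => ?_)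
  obtain ⟨h, hn⟩ := hn
  simp only [Function.comp_apply, entry_preIncl h]
  exact hn.re_normTrace_ramp_le hxz hzy

theorem le_norm_incl_central_of_eventually_eigenvalueCrosses {ω : Ultrafilter ℕ}
    (hω : ω ≤ (atTop : Filter ℕ)) {s s' : ℕ → I}
    (hcross : ∀ᶠ n in ω, ∃ h : m ≤ n, EigenvalueCrosses (S.map h) x y (s n) (s' n))
    (hxz : x ≤ z) (hzy : z ≤ y) {g : C(I, ℂ)} {r : ℝ} (hg : ∀ w : I, (w : ℝ) = z → r ≤ ‖g w‖) :
    r ≤ ‖S.incl m (central g)‖ := by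
  refine le_norm_incl hω (hcross.mono fun n hn => ?_)
  obtain ⟨h, hn⟩ := hn
  obtain ⟨w, hw, hle⟩ := hn.exists_forall_norm_apply_le hxz hzy
  exact ⟨h, (hg w hw).trans (hle g)⟩

open scoped ComplexOrder in
theorem eventually_forall_not_eigenvalueCrosses (hsimple : IsSimpleCStarAlgebra S.Limit)
    (hmono : IsMonotracial S.Limit) (m : ℕ) (hxy : x < y) :
    ∀ᶠ n in atTop, ∀ h : m ≤ n, ∀ s s', ¬ EigenvalueCrosses (S.map h) x y s s' := by
  by_contra hcon
  have hfreq : ∃ᶠ n in atTop, ∃ e : I × I, ∃ h : m ≤ n,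
      EigenvalueCrosses (S.map h) x y e.1 e.2 := by
    refine (not_eventually.1 hcon).mono fun n hn => ?_
    push Not at hn
    obtain ⟨h, s, s', hss⟩ := hn
    exact ⟨(s, s'), h, hss⟩
  obtain ⟨ω, hω, e, hcross⟩ := exists_ultrafilter_eventually_of_frequently hfreq
  obtain ⟨z, hxz, hzy⟩ := exists_between hxy
  obtain ⟨τ, hτ⟩ := hmono.exists
  obtain ⟨g, hg⟩ := exists_star_mul_complexify_eq_sub (ramp_le_ramp hxz hzy)
  let Ψ : C(I, ℂ) →⋆ₐ[ℂ] S.Limit := (S.incl m).comp central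
  have htrace : τ (star (Ψ g) * Ψ g) = 0 := by
    refine le_antisymm ?_ (hτ.map_star_mul_self_nonneg _)
    refine Complex.le_def.2 ⟨?_, (hτ.nonneg _).2⟩
    rw [← map_star, ← map_mul, hg, map_sub, map_sub, Complex.sub_re, Complex.zero_re, sub_nonpos]
    exact hmono.re_apply_ramp_le hτ hω hcross hxz hzy
  have hone (w : I) (hw : (w : ℝ) = z) : 1 ≤ ‖g w‖ := by
    have hgw := congrArg (fun f : C(I, ℂ) => ‖f w‖) hg
    simp only [ContinuousMap.mul_apply, ContinuousMap.star_apply, ContinuousMap.sub_apply,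
      complexify_apply, ramp_eq_one hzy hw.le, ramp_eq_zero hxz hw.ge, CStarRing.norm_star_mul_self,
      Complex.ofReal_one, Complex.ofReal_zero, sub_zero, norm_one] at hgw
    nlinarith [norm_nonneg (g w)]
  have hnorm : 1 ≤ ‖Ψ g‖ :=
    le_norm_incl_central_of_eventually_eigenvalueCrosses hω hcross hxz.le hzy.le hone
  rw [hτ.eq_zero_of_isSimple hsimple htrace, norm_zero] at hnorm
  exact hnorm.not_gt one_pos

theorem tendsto_variation_of_isSimple_of_isMonotracial (hpq : ∀ n, Nat.Coprime (p n) (q n))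
    (hsimple : IsSimpleCStarAlgebra S.Limit) (hmono : IsMonotracial S.Limit) (m : ℕ) :
    Tendsto (fun n : Set.Ici m => variation (S.map n.2)) atTop (𝓝 0) := by
  refine ENNReal.tendsto_nhds_zero.2 fun ε hε => ?_
  obtain ⟨r, hr0, hrε⟩ := ENNReal.lt_iff_exists_nnreal_btwn.1 hε
  have hδ : 0 < (r : ℝ) / 2 := half_pos (by exact_mod_cast hr0)
  have hgrid := (eventually_all_finset (Finset.range (⌊((r : ℝ) / 2)⁻¹⌋₊ + 1))).2 fun j _ =>
    eventually_forall_not_eigenvalueCrosses hsimple hmono m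
      (mul_lt_mul_of_pos_right (by linarith : (j : ℝ) + 1 < j + 2) hδ)
  filter_upwards [(map_val_Ici_atTop m).le hgrid] with n hn
  refine (variation_le_of_forall_not_eigenvalueCrosses (hpq m) hδ fun j hj =>
    hn j hj n.2).trans ?_
  rw [mul_div_cancel₀ _ two_ne_zero, ENNReal.ofReal_coe_nnreal]
  exact hrε.le

end LargeVariation

end JiangSu

end

theorem mainTheorem4 (p q : ℕ → ℕ) [∀ n, NeZero (p n)] [∀ n, NeZero (q n)]
    (hpq : ∀ n, Nat.Coprime (p n) (q n))
    (S : JiangSu.CStarSystem (fun n => JiangSu.DimDrop (p n) (q n))) :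
    (JiangSu.IsSimpleCStarAlgebra S.Limit ∧ JiangSu.IsMonotracial S.Limit) ↔
      ∀ m : ℕ, Tendsto (fun n : Set.Ici m => JiangSu.variation (S.map n.2)) atTop (𝓝 0) :=
  ⟨fun h m => JiangSu.tendsto_variation_of_isSimple_of_isMonotracial hpq h.1 h.2 m,
    fun hV => ⟨JiangSu.isSimple_of_tendsto_variation hV,
      JiangSu.isMonotracial_of_tendsto_variation hV⟩⟩
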